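/- Let $\mathcal{A}$ be a pointed Barr-exact Bourn-protomodular category, let $\mathcal{B}$ be a Birkhoff subcategory of $\mathcal{A}$ (a full reflective subcategory closed under subobjects and regular quotients), let $I\colon\mathcal{A}\to\mathcal{B}$ be the reflector, viewed as an endofunctor $I_0$ of $\mathcal{A}$, and let $\eta^0\colon 1_{\mathcal{A}}\Rightarrow I_0$ be the unit. **Extensions.** Let $\mathsf{Arr}^0\mathcal{A}=\mathcal{A}$ and let $\mathsf{Arr}^{k+1}\mathcal{A}$ be the category of arrows of $\mathsf{Arr}^k\mathcal{A}$. A $0$-extension is an object of $\mathcal{A}$, a $1$-extension is a regular epimorphism of $\mathcal{A}$, and, for $k\geq 1$, a $(k+1)$-extension is a commutative square in $\mathsf{Arr}^{k-1}\mathcal{A}$, that is, a morphism $(f',f)\colon b\to a$ in $\mathsf{Arr}^{k}\mathcal{A}$ with $b\colon B'\to B$ and $a\colon A'\to A$, such that the arrows $f'$, $f$, $a$, $b$, the two projections of the pullback $P=A'\times_A B$ and the comparison $B'\to P$ are all $k$-extensions. Write $\mathsf{Ext}^k\mathcal{A}$ for the full subcategory of $\mathsf{Arr}^k\mathcal{A}$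 on the $k$-extensions, and $\mathrm{cod},\ker\colon\mathsf{Ext}^{k+1}\mathcal{A}\to\mathsf{Ext}^k\mathcal{A}$ for the codomain and kernel functors, with $n$-fold iterates $\mathrm{cod}^n,\ker^n\colon\mathsf{Ext}^{k+n}\mathcal{A}\to\mathsf{Ext}^k\mathcal{A}$. **Centralisation.** Given $I_k$ and $\eta^k\colon 1\Rightarrow I_k$ on $\mathsf{Arr}^k\mathcal{A}$, put $J_k=\ker(\eta^k)$, with inclusion $\mu^k\colon J_k\Rightarrow 1$. For $f\colon B\to A$ in $\mathsf{Arr}^k\mathcal{A}$, with kernel pair $\pi_1,\pi_2\colon R[f]\to B$, let $I_{k+1}f\colon I_{k+1}[f]\to A$ be the arrow induced by $f$ on the cokernel of the composite $\ker(J_k\pi_1)\to J_kR[f]\xrightarrow{J_k\pi_2}J_kB\xrightarrow{\mu^k_B}B$, and let $\eta^{k+1}_f\colon f\to I_{k+1}f$ be the morphism given by the cokernel projection and $1_A$. The functors $I_k$ restrict to functors $I_k\colon\mathsf{Ext}^k\mathcal{A}\to\mathsf{Ext}^k\mathcal{A}$. A $(k+1)$-extension $f\colon B\to A$ is trivial when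 it is the pullback of $I_kf$ along $\eta^k_A$, and it is central when its pullback along some $(k+1)$-extension $A'\to A$ is trivial. **Homology.** Put $H_1(-,I_k)=I_k$. For $n\geq 1$ the homology functor $H_{n+1}(-,I_k)\colon\mathsf{Ext}^k\mathcal{A}\to\mathsf{Ext}^k\mathcal{A}$, with connecting transformation $\delta^{n+1}\colon H_{n+1}(-,I_k)\circ\mathrm{cod}\Rightarrow\ker\circ H_n(-,I_{k+1})$, is, if $H_n(-,I_{k+1})$ and it exist, the pointwise right Kan extension of $\ker\circ H_n(-,I_{k+1})$ along $\mathrm{cod}$. Composing the connecting transformations gives $\partial^{n+1}\colon H_{n+1}(-,I_k)\circ\mathrm{cod}^n\Rightarrow\ker^n\circ I_{k+n}$, hence, for every $k$-extension $A$, a cone on the diagram $\ker^n\circ I_{k+n}\circ U\colon(A\downarrow\mathrm{cod}^n)\to\mathsf{Ext}^k\mathcal{A}$ with vertex $H_{n+1}(A,I_k)$, where $U(f,g)=f$. For a given $A$, one also says that $H_{n+1}(A,I_k)$ exists when $H_n(-,I_{k+1})$ and the limit of $\ker\circ H_n(-,I_{k+1})\circ U$ over $(A\downarrow\mathrm{cod})$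 exist, or when the limit of $\ker^n\circ I_{k+n}\circ U$ over $(A\downarrow\mathrm{cod}^n)$ exists; then $H_{n+1}(A,I_k)$ is that limit, again with its canonical cone on $\ker^n\circ I_{k+n}\circ U$. **Extensions of an object.** For a $k$-extension $A$, let $\mathsf{Ext}^{k+n}_A\mathcal{A}$ be the category of $n$-extensions of $A$: its objects are the $(k+n)$-extensions $f$ with $\mathrm{cod}^nf=A$, and its morphisms are the morphisms of $(k+n)$-extensions sent to $1_A$ by $\mathrm{cod}^n$. Let $\mathsf{CExt}^{k+n}_A\mathcal{A}$ be its full subcategory on the central $(k+n)$-extensions. **Statement.** Let $k\geq 0$ and $n\geq 1$, and let $A$ be a $k$-extension such that $H_{n+1}(A,I_k)$ exists, in any of the above senses. 1. $H_{n+1}(A,I_k)$ is the limit of the diagram $\ker^n\circ I_{k+n}\colon\mathsf{Ext}^{k+n}_A\mathcal{A}\to\mathsf{Ext}^k\mathcal{A}$; the limit cone is the restriction of the canonical cone along $f\mapsto(f,1_A)$. 2. $H_{n+1}(A,I_k)$ is the limit of the diagram $\ker^n\colon\mathsf{CExt}^{k+n}_A\mathcal{A}\to\mathsf{Ext}^k\mathcal{A}$;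 there is a limit cone $\sigma$ with vertex $H_{n+1}(A,I_k)$ such that, for every central $n$-extension $f$ of $A$, the composite of $\sigma_f$ with $\ker^n(\eta^{k+n}_f)\colon\ker^nf\to\ker^n(I_{k+n}f)$ is the component at $f$ of the limit cone in 1. -/

import Mathlib

open CategoryTheory CategoryTheory.Limits

universe v u

namespace Satellite

/-- Pointed Barr-exact Bourn-protomodular categories.  `HasZeroMorphisms` together with the
terminal object provided by finite limits makes the category pointed; `Regular` says that it is
a regular category; `effective` is Barr-exactness (every internal equivalence relation is a kernel
pair); `splitShortFive` is the Split Short Five Lemma, which for pointed categories with finite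
limits is Bourn protomodularity. -/
class PointedExactProtomodular (C : Type u) [Category.{v} C] [HasZeroMorphisms C] : Prop
    extends Regular C where
  effective : ∀ {R X : C} (p₁ p₂ : R ⟶ X), IsEquivalenceRelation p₁ p₂ →
    ∃ (Y : C) (q : X ⟶ Y), IsKernelPair q p₁ p₂
  splitShortFive : ∀ {A B A' B' : C} (p : A ⟶ B) (s : B ⟶ A) (p' : A' ⟶ B') (s' : B' ⟶ A')
    (φ : A ⟶ A') (β : B ⟶ B') (_ : s ≫ p = 𝟙 B) (_ : s' ≫ p' = 𝟙 B')
    (w : p ≫ β = φ ≫ p') (_ : s ≫ φ = β ≫ s'),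
    IsIso β → IsIso (kernel.map p p' φ β w) → IsIso φ

/-- The images of kernels under split epimorphisms have cokernels. -/
class HasNormalImageCokernels (C : Type u) [Category.{v} C] [HasZeroMorphisms C] : Prop where
  hasCokernel : ∀ {N R Q B : C} (n : N ⟶ R) (g : R ⟶ Q) (π : R ⟶ B) (s : B ⟶ R),
    Mono n → n ≫ g = 0 → (∀ {X : C} (x : X ⟶ R), x ≫ g = 0 → ∃ y, y ≫ n = x) →
    s ≫ π = 𝟙 B → HasCokernel (n ≫ π)

attribute [local simp] pullback.lift_fst pullback.lift_snd pullback.lift_fst_assoc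
  pullback.lift_snd_assoc prod.lift_fst prod.lift_snd prod.lift_fst_assoc prod.lift_snd_assoc
  equalizer.lift_ι equalizer.lift_ι_assoc

section Exact

variable {C : Type u} [Category.{v} C] [HasZeroMorphisms C] [PointedExactProtomodular C]

/-- The kernel and the section of a split epimorphism are jointly extremally epic. -/
lemma isIso_of_kernel_section {A B E : C} (p : A ⟶ B) (s : B ⟶ A) (hs : s ≫ p = 𝟙 B)
    (m : E ⟶ A) [Mono m] (k' : kernel p ⟶ E) (hk : k' ≫ m = kernel.ι p)
    (s' : B ⟶ E) (hs' : s' ≫ m = s) : IsIso m := by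
  refine PointedExactProtomodular.splitShortFive (m ≫ p) s' p s m (𝟙 B)
    (by rw [← Category.assoc, hs', hs]) hs (by simp) (by simp [hs']) inferInstance ?_
  refine ⟨kernel.lift (m ≫ p) k' (by rw [← Category.assoc, hk]; simp), ?_, ?_⟩
  · rw [← cancel_mono (kernel.ι (m ≫ p)), ← cancel_mono m]
    simp [hk]
  · rw [← cancel_mono (kernel.ι p)]
    simp [hk]

/-- Reflexive relations are difunctional. -/
lemma difunctional {T B : C} (d₀ d₁ : T ⟶ B) [JointlyMono₂ d₀ d₁] {X : C} (t₁ t₂ t₃ : X ⟶ T)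
    (h₁ : t₁ ≫ d₁ = t₂ ≫ d₁) (h₂ : t₂ ≫ d₀ = t₃ ≫ d₀) :
    ∃ t : X ⟶ T, t ≫ d₀ = t₁ ≫ d₀ ∧ t ≫ d₁ = t₃ ≫ d₁ := by
  let a : pullback d₁ d₁ ⟶ T := pullback.snd d₁ d₁
  let b : pullback d₀ d₀ ⟶ T := pullback.fst d₀ d₀
  let f₀ : pullback a b ⟶ B := pullback.fst a b ≫ pullback.fst d₁ d₁ ≫ d₀
  let f₁ : pullback a b ⟶ B := pullback.snd a b ≫ pullback.snd d₀ d₀ ≫ d₁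
  let d : T ⟶ B ⨯ B := prod.lift d₀ d₁
  have hd : Mono d := ⟨fun x y h => JointlyMono₂.right_cancellation (p₁ := d₀) (p₂ := d₁) x y
    (by simpa [d] using congr($h ≫ prod.fst)) (by simpa [d] using congr($h ≫ prod.snd))⟩
  let m := pullback.fst (prod.lift f₀ f₁) d
  let e₁ : pullback d₁ d₁ ⟶ pullback a b :=
    pullback.lift (𝟙 _) (pullback.lift a a rfl) (by simp [b])
  let e₂ : pullback d₀ d₀ ⟶ pullback a b :=
    pullback.lift (pullback.lift b b rfl) (𝟙 _) (by simp [a])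
  let e₁' : pullback d₁ d₁ ⟶ pullback (prod.lift f₀ f₁) d :=
    pullback.lift e₁ (pullback.fst _ _) (by
      ext
      · simp [f₀, e₁, d]
      · simp [f₁, e₁, d, a, pullback.condition])
  let e₂' : pullback d₀ d₀ ⟶ pullback (prod.lift f₀ f₁) d :=
    pullback.lift e₂ (pullback.snd _ _) (by
      ext
      · simp [f₀, e₂, d, b, pullback.condition]
      · simp [f₁, e₂, d])
  have hker : (kernel.ι (pullback.fst a b) ≫ pullback.snd a b) ≫ e₂ =
      kernel.ι (pullback.fst a b) := by
    have h0 : kernel.ι (pullback.fst a b) ≫ pullback.snd a b ≫ b = 0 := by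
      rw [← pullback.condition]; simp
    apply pullback.hom_ext
    · apply pullback.hom_ext
      · simp [e₂, h0]
      · simp [e₂, h0]
    · simp [e₂]
  have : IsIso m := isIso_of_kernel_section (pullback.fst a b) e₁ (by simp [e₁]) m
    ((kernel.ι (pullback.fst a b) ≫ pullback.snd a b) ≫ e₂')
    (by simpa [m, e₂'] using hker) e₁' (by simp [m, e₁'])
  let x : X ⟶ pullback a b := pullback.lift (pullback.lift t₁ t₂ h₁) (pullback.lift t₂ t₃ h₂)
    (by simp [a, b])
  have hc : inv m ≫ pullback.snd (prod.lift f₀ f₁) d ≫ d = prod.lift f₀ f₁ := by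
    rw [← pullback.condition]; simp [m]
  refine ⟨x ≫ inv m ≫ pullback.snd (prod.lift f₀ f₁) d, ?_, ?_⟩
  · have := congr(x ≫ $hc ≫ prod.fst)
    simpa [d, f₀, x] using this
  · have := congr(x ≫ $hc ≫ prod.snd)
    simpa [d, f₁, x] using this

/-- A reflexive relation is an equivalence relation. -/
lemma isEquivalenceRelation_of_reflexive {T B : C} (d₀ d₁ : T ⟶ B) [h : JointlyMono₂ d₀ d₁]
    (r : B ⟶ T) (h₀ : r ≫ d₀ = 𝟙 B) (h₁ : r ≫ d₁ = 𝟙 B) : IsEquivalenceRelation d₀ d₁ := by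
  obtain ⟨s, hs₀, hs₁⟩ := difunctional d₀ d₁ (d₁ ≫ r) (𝟙 T) (d₀ ≫ r) (by simp [h₁]) (by simp [h₀])
  obtain ⟨t, ht₀, ht₁⟩ := difunctional d₀ d₁ (pullback.fst d₁ d₀) (pullback.fst d₁ d₀ ≫ d₁ ≫ r)
    (pullback.snd d₁ d₀) (by simp [h₁]) (by simp [h₀, pullback.condition])
  exact ⟨⟨{ toJointlyMono₂ := h
            r := r
            reflexivity₁ := h₀
            reflexivity₂ := h₁
            s := s
            symmetry₁ := by simpa [h₀] using hs₀
            symmetry₂ := by simpa [h₁] using hs₁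
            c := pullback.cone d₁ d₀
            isLimit := pullback.isLimit d₁ d₀
            t := t
            transitivity₁ := ht₀
            transitivity₂ := ht₁ }⟩⟩

/-- Reflexive pairs have coequalizers. -/
lemma exists_coequalizer_of_reflexive {S B : C} (p q : S ⟶ B) (r : B ⟶ S) (hp : r ≫ p = 𝟙 B)
    (hq : r ≫ q = 𝟙 B) : ∃ (Y : C) (c : B ⟶ Y), Epi c ∧ p ≫ c = q ≫ c ∧
      ∀ {Z : C} (z : B ⟶ Z), p ≫ z = q ≫ z → ∃ y, c ≫ y = z := by
  obtain ⟨T, e, m, he, hm, fac⟩ : ∃ (T : C) (e : S ⟶ T) (m : T ⟶ B ⨯ B),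
      Epi e ∧ Mono m ∧ e ≫ m = prod.lift p q :=
    ⟨_, (Regular.strongEpiMonoFactorisation (prod.lift p q)).e,
      (Regular.strongEpiMonoFactorisation (prod.lift p q)).m, inferInstance, inferInstance,
      (Regular.strongEpiMonoFactorisation (prod.lift p q)).fac⟩
  have hp' : e ≫ m ≫ prod.fst = p := by rw [← Category.assoc, fac]; simp
  have hq' : e ≫ m ≫ prod.snd = q := by rw [← Category.assoc, fac]; simp
  have : JointlyMono₂ (m ≫ prod.fst) (m ≫ prod.snd) := ⟨fun _ x y h h' => by
    rw [← cancel_mono m]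
    ext
    · simpa using h
    · simpa using h'⟩
  have := isEquivalenceRelation_of_reflexive (m ≫ prod.fst) (m ≫ prod.snd) (r ≫ e)
    (by simp [hp', hp]) (by simp [hq', hq])
  obtain ⟨Y, h, hh⟩ := PointedExactProtomodular.effective _ _ this
  have := Regular.hasCoequalizer_of_isKernelPair hh
  refine ⟨_, coequalizer.π (m ≫ prod.fst) (m ≫ prod.snd), inferInstance, ?_, fun z hz => ?_⟩
  · rw [← hp', ← hq', Category.assoc, coequalizer.condition]
    simp only [Category.assoc]
  · refine ⟨coequalizer.desc z ?_, coequalizer.π_desc _ _⟩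
    rw [← cancel_epi e]
    simp only [← Category.assoc] at hp' hq' ⊢
    rw [hp', hq', hz]

instance : HasNormalImageCokernels C where
  hasCokernel {N R Q B} n g π s hn w hl hs := by
    obtain ⟨Y, c, hc, hpq, hu⟩ := exists_coequalizer_of_reflexive
      (pullback.fst g g ≫ π) (pullback.snd g g ≫ π) (s ≫ pullback.lift (𝟙 R) (𝟙 R) rfl)
      (by simp [hs]) (by simp [hs])
    have h0 : (n ≫ π) ≫ c = 0 := by
      have := congr(pullback.lift (0 : N ⟶ R) n (by simp [w]) ≫ $hpq)
      simpa using this.symm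
    refine ⟨⟨⟨CokernelCofork.ofπ c h0, CokernelCofork.IsColimit.ofπ' _ _ fun {Z} z hz => ?_⟩⟩⟩
    refine ⟨(hu z ?_).choose, (hu z ?_).choose_spec⟩
    all_goals
      let e := equalizer.ι (pullback.fst g g ≫ π ≫ z) (pullback.snd g g ≫ π ≫ z)
      have hk : kernel.ι (pullback.fst g g) ≫ (pullback.fst g g ≫ π ≫ z) =
          kernel.ι (pullback.fst g g) ≫ (pullback.snd g g ≫ π ≫ z) := by
        obtain ⟨y, hy⟩ := hl (kernel.ι (pullback.fst g g) ≫ pullback.snd g g)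
          (by rw [Category.assoc, ← pullback.condition]; simp)
        rw [← Category.assoc _ (pullback.snd g g), ← hy]
        simp only [Category.assoc] at hz
        simp [hz]
      have : IsIso e := isIso_of_kernel_section (pullback.fst g g)
        (pullback.lift (𝟙 R) (𝟙 R) rfl) (by simp) e (equalizer.lift _ hk) (by simp [e])
        (equalizer.lift (pullback.lift (𝟙 R) (𝟙 R) rfl) (by simp)) (by simp [e])
      have := equalizer.condition (pullback.fst g g ≫ π ≫ z) (pullback.snd g g ≫ π ≫ z)
      simpa only [Category.assoc] using (cancel_epi e).1 this

end Exact

noncomputable section Arrows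

variable {C : Type u} [Category.{v} C] [HasZeroMorphisms C]

/-- Zero morphisms of arrows are componentwise. -/
instance arrowHasZeroMorphisms : HasZeroMorphisms (Arrow C) where
  zero _ _ := ⟨Arrow.homMk 0 0 (by simp)⟩
  comp_zero _ _ := by apply Arrow.hom_ext <;> exact comp_zero
  zero_comp _ _ _ _ := by apply Arrow.hom_ext <;> exact zero_comp

lemma arrow_zero_left (f g : Arrow C) : (0 : f ⟶ g).left = 0 := rfl

lemma arrow_zero_right (f g : Arrow C) : (0 : f ⟶ g).right = 0 := rfl

variable {f g h k : Arrow C}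

/-- `Arrow.leftFunc` is represented by identity arrows. -/
def fromId {X : C} (f : Arrow C) (x : X ⟶ f.left) : Arrow.mk (𝟙 X) ⟶ f :=
  Arrow.homMk x (x ≫ f.hom) (by simp)

/-- `Arrow.rightFunc` is left adjoint to sending `X` to its identity. -/
def toId {X : C} (f : Arrow C) (x : f.right ⟶ X) : f ⟶ Arrow.mk (𝟙 X) :=
  Arrow.homMk (f.hom ≫ x) x (by simp)

variable [HasFiniteLimits C]

/-- `Arrow.rightFunc` is represented by the arrows with domain zero. -/
def fromZero {X : C} (f : Arrow C) (x : X ⟶ f.right) :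
    Arrow.mk (0 : ⊤_ C ⟶ X) ⟶ f :=
  Arrow.homMk 0 x (by simp)

/-- `Arrow.leftFunc` is left adjoint to sending `X` to the arrow from `X` to zero. -/
def toZero {X : C} (f : Arrow C) (x : f.left ⟶ X) :
    f ⟶ Arrow.mk (0 : X ⟶ ⊤_ C) :=
  Arrow.homMk x 0 (by simp)

lemma isZero_top : IsZero (⊤_ C) := by
  have := hasZeroObject_of_hasTerminal_object (C := C)
  exact (isZero_zero C).of_iso (HasZeroObject.zeroIsoIsTerminal terminalIsTerminal).symm

lemma top_hom_ext {X : C} (x y : ⊤_ C ⟶ X) : x = y := isZero_top.eq_of_src x y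

lemma arrow_mono_left (m : f ⟶ g) [Mono m] : Mono m.left := ⟨fun {X} x y e => by
  have : fromId f x ≫ m = fromId f y ≫ m := by
    apply Arrow.hom_ext
    · exact e
    · change (x ≫ f.hom) ≫ m.right = (y ≫ f.hom) ≫ m.right
      rw [Category.assoc, Category.assoc, ← Arrow.w m, reassoc_of% e]
  exact congr_arg CommaMorphism.left ((cancel_mono m).1 this)⟩

lemma arrow_mono_right (m : f ⟶ g) [Mono m] : Mono m.right := ⟨fun {X} x y e => by
  have : fromZero f x ≫ m = fromZero f y ≫ m := by
    apply Arrow.hom_ext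
    · exact top_hom_ext _ _
    · exact e
  exact congr_arg CommaMorphism.right ((cancel_mono m).1 this)⟩

lemma isPullback_left {p : f ⟶ g} {q : f ⟶ h} {r : g ⟶ k} {s : h ⟶ k} (H : IsPullback p q r s) :
    IsPullback p.left q.left r.left s.left :=
  ⟨⟨congr_arg CommaMorphism.left H.w⟩, ⟨PullbackCone.IsLimit.mk _
    (fun c => (H.lift (fromId g c.fst) (fromId h c.snd) (by
      apply Arrow.hom_ext
      · exact c.condition
      · simp [fromId, ← Arrow.w, reassoc_of% c.condition])).left)
    (fun c => congr_arg CommaMorphism.left (H.lift_fst _ _ _))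
    (fun c => congr_arg CommaMorphism.left (H.lift_snd _ _ _))
    (fun c m h₁ h₂ => by
      refine congr_arg CommaMorphism.left (?_ : fromId f m = _)
      apply H.hom_ext
      · rw [H.lift_fst]
        apply Arrow.hom_ext
        · exact h₁
        · simp [fromId, ← Arrow.w, reassoc_of% h₁]
      · rw [H.lift_snd]
        apply Arrow.hom_ext
        · exact h₂
        · simp [fromId, ← Arrow.w, reassoc_of% h₂])⟩⟩

lemma isPullback_right {p : f ⟶ g} {q : f ⟶ h} {r : g ⟶ k} {s : h ⟶ k} (H : IsPullback p q r s) :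
    IsPullback p.right q.right r.right s.right :=
  ⟨⟨congr_arg CommaMorphism.right H.w⟩, ⟨PullbackCone.IsLimit.mk _
    (fun c => (H.lift (fromZero g c.fst) (fromZero h c.snd) (by
      apply Arrow.hom_ext
      · exact top_hom_ext _ _
      · exact c.condition)).right)
    (fun c => congr_arg CommaMorphism.right (H.lift_fst _ _ _))
    (fun c => congr_arg CommaMorphism.right (H.lift_snd _ _ _))
    (fun c m h₁ h₂ => by
      refine congr_arg CommaMorphism.right (?_ : fromZero f m = _)
      apply H.hom_ext
      · rw [H.lift_fst]
        apply Arrow.hom_ext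
        · exact top_hom_ext _ _
        · exact h₁
      · rw [H.lift_snd]
        apply Arrow.hom_ext
        · exact top_hom_ext _ _
        · exact h₂)⟩⟩

lemma arrow_isZero (hl : IsZero f.left) (hr : IsZero f.right) : IsZero f := by
  rw [IsZero.iff_id_eq_zero]
  apply Arrow.hom_ext
  · exact hl.eq_of_src _ _
  · exact hr.eq_of_src _ _

lemma arrow_isZero_left (hf : IsZero f) : IsZero f.left := by
  rw [IsZero.iff_id_eq_zero] at hf ⊢
  exact congr_arg CommaMorphism.left hf

lemma arrow_isZero_right (hf : IsZero f) : IsZero f.right := by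
  rw [IsZero.iff_id_eq_zero] at hf ⊢
  exact congr_arg CommaMorphism.right hf

instance [HasNormalImageCokernels C] : HasNormalImageCokernels (Arrow C) where
  hasCokernel {N R Q B} n g π s hn w hl hs := by
    have := arrow_mono_left n
    have := arrow_mono_right n
    have hcl : HasCokernel (n.left ≫ π.left) :=
      HasNormalImageCokernels.hasCokernel n.left g.left π.left s.left inferInstance
        (congr_arg CommaMorphism.left w) (fun x hx => by
          obtain ⟨y, hy⟩ := hl (fromId R x) (by
            apply Arrow.hom_ext
            · exact hx
            · simp [fromId, ← Arrow.w, reassoc_of% hx, arrow_zero_right])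
          exact ⟨y.left, congr_arg CommaMorphism.left hy⟩)
        (congr_arg CommaMorphism.left hs)
    have hcr : HasCokernel (n.right ≫ π.right) :=
      HasNormalImageCokernels.hasCokernel n.right g.right π.right s.right inferInstance
        (congr_arg CommaMorphism.right w) (fun x hx => by
          obtain ⟨y, hy⟩ := hl (fromZero R x) (by
            apply Arrow.hom_ext
            · exact top_hom_ext _ _
            · exact hx)
          exact ⟨y.right, congr_arg CommaMorphism.right hy⟩)
        (congr_arg CommaMorphism.right hs)
    let c : B ⟶ Arrow.mk (cokernel.map (n.left ≫ π.left) (n.right ≫ π.right) N.hom B.hom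
      (by simp)) := Arrow.homMk (cokernel.π _) (cokernel.π _) (by simp)
    have hc : (n ≫ π) ≫ c = 0 := by
      apply Arrow.hom_ext
      · exact cokernel.condition (n.left ≫ π.left)
      · exact cokernel.condition (n.right ≫ π.right)
    refine ⟨⟨⟨CokernelCofork.ofπ c hc, CokernelCofork.IsColimit.ofπ _ _
      (fun {Z} z hz => Arrow.homMk
        (cokernel.desc _ z.left (congr_arg CommaMorphism.left hz))
        (cokernel.desc _ z.right (congr_arg CommaMorphism.right hz)) ?_)
      (fun {Z} z hz => ?_) (fun {Z} z hz m hm => ?_)⟩⟩⟩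
    · dsimp
      rw [← cancel_epi (cokernel.π (n.left ≫ π.left))]
      refine (cokernel.π_desc_assoc (n.left ≫ π.left) _ (congr_arg CommaMorphism.left hz) _).trans
        ((Arrow.w z).trans ?_)
      rw [cokernel.π_desc_assoc, Category.assoc]
      exact congrArg (B.hom ≫ ·) (cokernel.π_desc (n.right ≫ π.right) _
        (congr_arg CommaMorphism.right hz)).symm
    · apply Arrow.hom_ext
      · exact cokernel.π_desc _ _ _
      · exact cokernel.π_desc _ _ _
    · apply Arrow.hom_ext
      · refine (cancel_epi (cokernel.π (n.left ≫ π.left))).1 ?_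
        exact (congr_arg CommaMorphism.left hm).trans (cokernel.π_desc _ _ _).symm
      · refine (cancel_epi (cokernel.π (n.right ≫ π.right))).1 ?_
        exact (congr_arg CommaMorphism.right hm).trans (cokernel.π_desc _ _ _).symm

end Arrows

noncomputable section Centralisation

variable {C : Type u} [Category.{v} C] [HasZeroMorphisms C] [HasFiniteLimits C]
  {F : C ⥤ C} (η : 𝟭 C ⟶ F)

/-- The functor `J` with `J X = K[η_X]`. -/
def J : C ⥤ C where
  obj X := kernel (η.app X)
  map f := kernel.map _ _ f (F.map f) (η.naturality f).symm
  map_id X := by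
    rw [← cancel_mono (kernel.ι (η.app X))]
    simp
  map_comp f g := by
    rw [← cancel_mono (kernel.ι _)]
    simp

/-- The kernel `μ` of `η`. -/
def μ : J η ⟶ 𝟭 C where
  app X := kernel.ι (η.app X)
  naturality X Y f := by simp [J]

lemma μ_η (X : C) : (μ η).app X ≫ η.app X = 0 := kernel.condition _

instance (X : C) : Mono ((μ η).app X) := inferInstanceAs (Mono (kernel.ι (η.app X)))

lemma μ_nat {X Y : C} (f : X ⟶ Y) : (J η).map f ≫ (μ η).app Y = (μ η).app X ≫ f :=
  (μ η).naturality f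

lemma exists_J_lift {X Y : C} (x : X ⟶ Y) (h : x ≫ η.app Y = 0) :
    ∃ y : X ⟶ (J η).obj Y, y ≫ (μ η).app Y = x :=
  ⟨kernel.lift _ x h, kernel.lift_ι _ _ _⟩

/-- The morphism induced between the kernel pairs. -/
def kernelPairMap {f g : Arrow C} (φ : f ⟶ g) :
    pullback f.hom f.hom ⟶ pullback g.hom g.hom :=
  pullback.map f.hom f.hom g.hom g.hom φ.left φ.left φ.right (by simp) (by simp)

/-- The object `J₁[f] = K[J π₁]`, where `π₁` and `π₂` are the kernel pair projections of `f`. -/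
abbrev J₁ (f : Arrow C) : C := kernel ((J η).map (pullback.fst f.hom f.hom))

/-- The composite `J₁[f] ⟶ J R[f] ⟶ J B ⟶ B` of the kernel of `J π₁`, of `J π₂` and of `μ_B`. -/
def ν (f : Arrow C) : J₁ η f ⟶ f.left :=
  kernel.ι ((J η).map (pullback.fst f.hom f.hom)) ≫
    (J η).map (pullback.snd f.hom f.hom) ≫ (μ η).app f.left

/-- The inclusion of `J₁[f]` into the kernel pair of `f`. -/
def νR (f : Arrow C) : J₁ η f ⟶ pullback f.hom f.hom :=
  kernel.ι ((J η).map (pullback.fst f.hom f.hom)) ≫ (μ η).app (pullback f.hom f.hom)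

instance (f : Arrow C) : Mono (νR η f) := mono_comp _ _

lemma νR_η (f : Arrow C) : νR η f ≫ η.app (pullback f.hom f.hom) = 0 := by
  rw [νR, Category.assoc, μ_η, comp_zero]

lemma νR_fst (f : Arrow C) : νR η f ≫ pullback.fst f.hom f.hom = 0 := by
  rw [νR, Category.assoc, ← μ_nat, kernel.condition_assoc, zero_comp]

lemma νR_snd (f : Arrow C) : νR η f ≫ pullback.snd f.hom f.hom = ν η f := by
  rw [νR, ν, Category.assoc, ← μ_nat]

lemma ν_hom (f : Arrow C) : ν η f ≫ f.hom = 0 := by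
  rw [← νR_snd, Category.assoc, ← pullback.condition, ← Category.assoc, νR_fst, zero_comp]

/-- The action of `J₁` on morphisms. -/
def J₁map {f g : Arrow C} (φ : f ⟶ g) : J₁ η f ⟶ J₁ η g :=
  kernel.map _ _ ((J η).map (kernelPairMap φ)) ((J η).map φ.left) (by
    rw [← (J η).map_comp, ← (J η).map_comp]
    simp [kernelPairMap])

lemma J₁map_ν {f g : Arrow C} (φ : f ⟶ g) : J₁map η φ ≫ ν η g = ν η f ≫ φ.left := by
  simp only [J₁map, ν, Category.assoc, kernel.lift_ι_assoc, ← μ_nat]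
  rw [← (J η).map_comp_assoc, ← (J η).map_comp_assoc]
  simp [kernelPairMap]

variable [HasNormalImageCokernels C]

instance (f : Arrow C) : HasCokernel (ν η f) := by
  rw [← νR_snd]
  refine HasNormalImageCokernels.hasCokernel (νR η f)
    (prod.lift (η.app (pullback f.hom f.hom)) (pullback.fst f.hom f.hom))
    (pullback.snd f.hom f.hom)
    (pullback.lift (𝟙 _) (𝟙 _) rfl) inferInstance ?_ (fun {X} x hx => ?_) (by simp)
  · rw [prod.comp_lift, νR_η, νR_fst]
    ext <;> simp
  · have h₁ : x ≫ η.app (pullback f.hom f.hom) = 0 := by simpa using congr($hx ≫ prod.fst)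
    have h₂ : x ≫ pullback.fst f.hom f.hom = 0 := by simpa using congr($hx ≫ prod.snd)
    obtain ⟨y, hy⟩ := exists_J_lift η x h₁
    refine ⟨kernel.lift _ y ?_, by rw [νR, kernel.lift_ι_assoc, hy]⟩
    rw [← cancel_mono ((μ η).app f.left), Category.assoc, μ_nat, ← Category.assoc, hy, h₂,
      zero_comp]

/-- The arrow `I₁ f : I₁[f] ⟶ A` induced by `f : B ⟶ A` on the cokernel `I₁[f]` of
`J₁[f] ⟶ B`. -/
abbrev I₁obj (f : Arrow C) : Arrow C := Arrow.mk (cokernel.desc (ν η f) f.hom (ν_hom η f))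

/-- The action of `I₁` on morphisms. -/
def I₁map {f g : Arrow C} (φ : f ⟶ g) : I₁obj η f ⟶ I₁obj η g :=
  Arrow.homMk
    (cokernel.map (ν η f) (ν η g) (J₁map η φ) φ.left (J₁map_ν η φ).symm) φ.right (by
      dsimp
      rw [← cancel_epi (cokernel.π (ν η f))]
      simp [cokernel.π_desc, cokernel.π_desc_assoc])

/-- The morphism `η¹_f : f ⟶ I₁ f`, with components `B ⟶ I₁[f]` and `1_A`. -/
def η₁app (f : Arrow C) : f ⟶ I₁obj η f :=
  Arrow.homMk (cokernel.π (ν η f)) (𝟙 f.right) (by simp [cokernel.π_desc])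

lemma η₁app_left (f : Arrow C) : (η₁app η f).left = cokernel.π (ν η f) := rfl

lemma η₁app_right (f : Arrow C) : (η₁app η f).right = 𝟙 f.right := rfl

lemma η₁app_nat {f g : Arrow C} (φ : f ⟶ g) : η₁app η f ≫ I₁map η φ = φ ≫ η₁app η g := by
  apply Arrow.hom_ext
  · exact cokernel.π_desc _ _ _
  · exact (Category.id_comp _).trans (Category.comp_id _).symm

instance (f : Arrow C) : Epi (η₁app η f) where
  left_cancellation x y h := by
    apply Arrow.hom_ext
    · exact (cancel_epi (cokernel.π (ν η f))).1 (congr_arg CommaMorphism.left h)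
    · exact (cancel_epi (𝟙 f.right)).1 (congr_arg CommaMorphism.right h)

/-- The functor `I₁`, sending `f : B ⟶ A` to the arrow `I₁[f] ⟶ A` induced on the cokernel
`I₁[f]` of `J₁[f] ⟶ B`. -/
def I₁ : Arrow C ⥤ Arrow C where
  obj f := I₁obj η f
  map φ := I₁map η φ
  map_id f := by
    rw [← cancel_epi (η₁app η f), η₁app_nat, Category.id_comp, Category.comp_id]
  map_comp φ ψ := by
    rw [← cancel_epi (η₁app η _), η₁app_nat, ← Category.assoc (η₁app η _), η₁app_nat,
      Category.assoc, Category.assoc, η₁app_nat]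

/-- The natural transformation `η¹`, with components `B ⟶ I₁[f]` and `1_A`. -/
def η₁ : 𝟭 (Arrow C) ⟶ I₁ η where
  app f := η₁app η f
  naturality _ _ φ := (η₁app_nat η φ).symm

end Centralisation

section Extensions

variable {C : Type u} [Category.{v} C]

/-- Given a class `E` of morphisms, a commutative square (a morphism `φ = (f', f) : b ⟶ a` of
arrows) is a double `E`-extension when all arrows in the diagram formed by the square,
the pullback `P` of `a` and `f`, its projections, and the comparison morphism to `P` are in `E`. -/
structure IsDoubleExtension [HasFiniteLimits C] (E : MorphismProperty C) {b a : Arrow C}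
    (φ : b ⟶ a) : Prop where
  source : E b.hom
  target : E a.hom
  left : E φ.left
  right : E φ.right
  fst : E (pullback.fst a.hom φ.right)
  snd : E (pullback.snd a.hom φ.right)
  comparison : E (pullback.lift φ.left b.hom (Arrow.w φ) : b.left ⟶ pullback a.hom φ.right)

/-- The class of double `E`-extensions, as a class of morphisms of arrows. -/
def doubleExtension [HasFiniteLimits C] (E : MorphismProperty C) : MorphismProperty (Arrow C) :=
  fun _ _ φ => IsDoubleExtension E φ

/-- An extension `f : B ⟶ A` is trivial when it is the pullback of `I f` along `η_A`. -/
def IsTrivialExtension (E : MorphismProperty C) {I : C ⥤ C} (η : 𝟭 C ⟶ I) (f : Arrow C) : Prop :=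
  E f.hom ∧ IsPullback (η.app f.left) f.hom (I.map f.hom) (η.app f.right)

/-- An extension `f : B ⟶ A` is central when its pullback along some extension `g : A' ⟶ A` is
trivial. -/
def IsCentralExtension [HasFiniteLimits C] (E : MorphismProperty C) {I : C ⥤ C} (η : 𝟭 C ⟶ I) :
    ObjectProperty (Arrow C) :=
  fun f => E f.hom ∧ ∃ (A' : C) (g : A' ⟶ f.right), E g ∧
    IsTrivialExtension E η (Arrow.mk (pullback.snd f.hom g))

/-- The facts on extensions that are needed in order to see that kernels and centralisations of
extensions are extensions.  Here `O` stands for the `k`-extensions and `E` for the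
`(k+1)`-extensions, `T` is a class of morphisms between `k`-cubes which are invertible outside the
initial vertices, and `Z` is a class of `k`-cubes which vanish outside the initial vertex. -/
structure ExtensionLaws [HasZeroMorphisms C] (O : ObjectProperty C) (E : MorphismProperty C)
    {I : C ⥤ C} (η : 𝟭 C ⟶ I) (T : MorphismProperty C) (Z : ObjectProperty C) : Prop where
  src : ∀ {X Y : C} (f : X ⟶ Y), E f → O X
  tgt : ∀ {X Y : C} (f : X ⟶ Y), E f → O Y
  zero : ∀ {X Y : C} (f : X ⟶ Y), IsZero X → IsZero Y → E f
  comp : ∀ {X Y W : C} (f : X ⟶ Y) (g : Y ⟶ W), E f → E g → E (f ≫ g)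
  pullback : ∀ {P X Y W : C} {p : P ⟶ X} {q : P ⟶ Y} {f : X ⟶ W} {g : Y ⟶ W},
    IsPullback p q f g → E f → O Y → E q
  corner_isIso : ∀ {X Y : C} (t : X ⟶ Y), IsIso t → T t
  corner_ker : ∀ {X Y W : C} (n : W ⟶ X) (t : X ⟶ Y), T t → Mono n → n ≫ t = 0 → Z W
  corner_coker : ∀ {X Y W : C} (n : W ⟶ X) (t : X ⟶ Y) (w : n ≫ t = 0),
    Nonempty (IsColimit (CokernelCofork.ofπ t w)) → Z W → T t
  corner_obj : ∀ {X Y : C} (t : X ⟶ Y), T t → O X → O Y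
  corner_arrow : ∀ {X Y X' Y' : C} (f : X ⟶ Y) (f' : X' ⟶ Y') (t : X ⟶ X') (w : Y ⟶ Y'),
    t ≫ f' = f ≫ w → T t → IsIso w → E f → E f'
  corner_unit : ∀ X : C, T (η.app X)

variable [HasZeroMorphisms C] [HasFiniteLimits C]
  {O : ObjectProperty C} {E : MorphismProperty C} {I : C ⥤ C} {η : 𝟭 C ⟶ I}
  {T : MorphismProperty C} {Z : ObjectProperty C}

lemma ExtensionLaws.ext_obj (h : ExtensionLaws O E η T Z) {X : C} (hX : O X) : O (I.obj X) :=
  h.corner_obj _ (h.corner_unit X) hX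

lemma ExtensionLaws.kernel (h : ExtensionLaws O E η T Z) {X Y : C} (f : X ⟶ Y) (hf : E f) :
    O (kernel f) := by
  have hz : IsZero (⊤_ C) := isZero_top
  have hp : IsPullback (kernel.ι f) (0 : Limits.kernel f ⟶ ⊤_ C) f (0 : ⊤_ C ⟶ Y) :=
    ⟨⟨by simp⟩, ⟨PullbackCone.IsLimit.mk _
      (fun c => kernel.lift f c.fst (by rw [c.condition, comp_zero]))
      (fun c => by simp) (fun c => hz.eq_of_tgt _ _)
      (fun c m h₁ h₂ => by rw [← cancel_mono (kernel.ι f)]; simp [h₁])⟩⟩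
  exact h.src _ (h.pullback hp hf (h.src _ (h.zero (𝟙 (⊤_ C)) hz hz)))

lemma ExtensionLaws.next [HasNormalImageCokernels C] (h : ExtensionLaws O E η T Z) :
    ExtensionLaws (fun f : Arrow C => E f.hom) (doubleExtension E) (η₁ η)
      (fun _ _ t => T t.left ∧ IsIso t.right) (fun f => Z f.left ∧ IsZero f.right) where
  src _ hf := hf.source
  tgt _ hf := hf.target
  zero {b a} φ hb ha := by
    have hb₁ := arrow_isZero_left hb
    have hb₂ := arrow_isZero_right hb
    have ha₁ := arrow_isZero_left ha
    have ha₂ := arrow_isZero_right ha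
    have hP : IsZero (Limits.pullback a.hom φ.right) := by
      rw [IsZero.iff_id_eq_zero]
      apply pullback.hom_ext
      · exact ha₁.eq_of_tgt _ _
      · exact hb₂.eq_of_tgt _ _
    exact ⟨h.zero _ hb₁ hb₂, h.zero _ ha₁ ha₂, h.zero _ hb₁ ha₁, h.zero _ hb₂ ha₂,
      h.zero _ hP ha₁, h.zero _ hP hb₂, h.zero _ hb₁ hP⟩
  comp {b a e} φ ψ hφ hψ := by
    have hr : E (φ.right ≫ ψ.right) := h.comp _ _ hφ.right hψ.right
    have hQ := IsPullback.of_hasPullback e.hom (φ.right ≫ ψ.right)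
    have hfst : E (pullback.fst e.hom (φ.right ≫ ψ.right)) :=
      h.pullback hQ.flip hr (h.src _ hψ.target)
    have hPψ := IsPullback.of_hasPullback e.hom ψ.right
    have hPφ := IsPullback.of_hasPullback a.hom φ.right
    let c : Limits.pullback e.hom (φ.right ≫ ψ.right) ⟶ Limits.pullback e.hom ψ.right :=
      pullback.lift (pullback.fst _ _) (pullback.snd _ _ ≫ φ.right)
        (by rw [pullback.condition, Category.assoc])
    let t : Limits.pullback a.hom φ.right ⟶ Limits.pullback e.hom (φ.right ≫ ψ.right) :=
      pullback.lift (pullback.fst _ _ ≫ ψ.left) (pullback.snd _ _) (by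
        rw [Category.assoc, Arrow.w ψ, pullback.condition_assoc])
    have h₁ : IsPullback c (pullback.snd e.hom (φ.right ≫ ψ.right)) (pullback.snd e.hom ψ.right)
        φ.right := by
      refine IsPullback.of_right ?_ (by simp [c]) hPψ
      simpa [c] using hQ
    have h₂ : IsPullback (pullback.fst a.hom φ.right) t
        (pullback.lift ψ.left a.hom (Arrow.w ψ)) c := by
      refine IsPullback.of_bot ?_ ?_ h₁
      · simpa [t] using hPφ
      · apply pullback.hom_ext
        · simp [c, t]
        · simp [c, t, pullback.condition]
    exact ⟨hφ.source, hψ.target, h.comp _ _ hφ.left hψ.left, hr, hfst,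
      h.pullback hQ hψ.target (h.src _ hφ.right), by
        have ht : E t := h.pullback h₂ hψ.comparison (h.src _ hfst)
        have := h.comp _ _ hφ.comparison ht
        have e₁ : pullback.lift φ.left b.hom (Arrow.w φ) ≫ t = pullback.lift (φ ≫ ψ).left b.hom
            (Arrow.w (φ ≫ ψ)) := by
          apply pullback.hom_ext
          · refine Eq.trans ?_
              (pullback.lift_fst (f := e.hom) (g := (φ ≫ ψ).right) _ _ _).symm
            simp [t]
          · refine Eq.trans ?_
              (pullback.lift_snd (f := e.hom) (g := (φ ≫ ψ).right) _ _ _).symm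
            simp [t]
        rwa [e₁] at this⟩
  pullback {d b c a} p q φ ψ H hφ hc := by
    have Hl := isPullback_left H
    have Hr := isPullback_right H
    have hql : E q.left := h.pullback Hl hφ.left (h.src _ hc)
    have hqr : E q.right := h.pullback Hr hφ.right (h.tgt _ hc)
    have hP := IsPullback.of_hasPullback c.hom q.right
    have hfst : E (pullback.fst c.hom q.right) := h.pullback hP.flip hqr (h.src _ hc)
    have hsnd : E (pullback.snd c.hom q.right) := h.pullback hP hc (h.src _ hqr)
    let s : Limits.pullback c.hom q.right ⟶ Limits.pullback a.hom φ.right :=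
      pullback.lift (pullback.fst _ _ ≫ ψ.left) (pullback.snd _ _ ≫ p.right) (by
        rw [Category.assoc, Category.assoc, Arrow.w ψ, pullback.condition_assoc, Hr.w])
    have h₁ : IsPullback s (pullback.fst c.hom q.right) (pullback.fst a.hom φ.right) ψ.left := by
      refine IsPullback.of_right ?_ (by simp [s]) (IsPullback.of_hasPullback a.hom φ.right).flip
      have := hP.flip.paste_horiz Hr
      rw [← Arrow.w ψ] at this
      simpa [s] using this
    have h₂ : IsPullback p.left (pullback.lift q.left d.hom (Arrow.w q))
        (pullback.lift φ.left b.hom (Arrow.w φ)) s := by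
      refine IsPullback.of_bot ?_ ?_ h₁
      · simpa using Hl
      · apply pullback.hom_ext
        · simpa [s] using Hl.w
        · simp [s]
    have hcomp : E (pullback.lift q.left d.hom (Arrow.w q)) :=
      h.pullback h₂ hφ.comparison (h.src _ hfst)
    refine ⟨?_, hc, hql, hqr, hfst, hsnd, hcomp⟩
    have := h.comp _ _ hcomp hsnd
    rwa [pullback.lift_snd] at this
  corner_isIso t ht := ⟨h.corner_isIso _ inferInstance, inferInstance⟩
  corner_ker n t ht hn w :=
    ⟨h.corner_ker n.left t.left ht.1 (arrow_mono_left n) (congr_arg CommaMorphism.left w), by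
      have := ht.2
      have := arrow_mono_right n
      have w' : n.right ≫ t.right = 0 := congr_arg CommaMorphism.right w
      have : n.right = 0 := by rw [← cancel_mono t.right, w', zero_comp]
      exact IsZero.of_mono_eq_zero _ this⟩
  corner_coker {X Y W} n t w hc hW := by
    obtain ⟨hc⟩ := hc
    have hd : ∀ {V : Arrow C} (k : X ⟶ V), n ≫ k = 0 → ∃ l : Y ⟶ V, t ≫ l = k := fun k hk =>
      ⟨(CokernelCofork.IsColimit.desc' hc k hk).1, (CokernelCofork.IsColimit.desc' hc k hk).2⟩
    have ht : Epi t := ⟨fun x y e => Cofork.IsColimit.hom_ext hc e⟩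
    have htl : Epi t.left := ⟨fun x y e => by
      have : t ≫ toZero Y x = t ≫ toZero Y y := by
        apply Arrow.hom_ext
        · exact e
        · exact isZero_top.eq_of_tgt _ _
      exact congr_arg CommaMorphism.left ((cancel_epi t).1 this)⟩
    have htr : Epi t.right := ⟨fun x y e => by
      have : t ≫ toId Y x = t ≫ toId Y y := by
        apply Arrow.hom_ext
        · change t.left ≫ Y.hom ≫ x = t.left ≫ Y.hom ≫ y
          rw [Arrow.w_assoc, Arrow.w_assoc, e]
        · exact e
      exact congr_arg CommaMorphism.right ((cancel_epi t).1 this)⟩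
    have wl : n.left ≫ t.left = 0 := congr_arg CommaMorphism.left w
    refine ⟨h.corner_coker n.left t.left wl ⟨CokernelCofork.IsColimit.ofπ' _ _ fun {V} k hk => ?_⟩
      hW.1, ?_⟩
    · have hk' : n ≫ toZero X k = 0 := by
        apply Arrow.hom_ext
        · exact hk
        · exact isZero_top.eq_of_tgt _ _
      exact ⟨(hd _ hk').choose.left, congr_arg CommaMorphism.left (hd _ hk').choose_spec⟩
    · obtain ⟨l, hl⟩ := hd (toId X (𝟙 X.right)) (by
        apply Arrow.hom_ext
        · change n.left ≫ X.hom ≫ 𝟙 X.right = 0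
          rw [Category.comp_id, Arrow.w n, hW.2.eq_of_src n.right 0, comp_zero]
        · exact hW.2.eq_of_src _ _)
      have hr : t.right ≫ l.right = 𝟙 X.right := congr_arg CommaMorphism.right hl
      exact ⟨l.right, hr, by rw [← cancel_epi t.right, reassoc_of% hr, Category.comp_id]⟩
  corner_obj t ht hX := h.corner_arrow _ _ t.left t.right (Arrow.w t) ht.1 ht.2 hX
  corner_arrow {b a b' a'} φ φ' t w e ht hw hφ := by
    have e₁ : t.left ≫ φ'.left = φ.left ≫ w.left := congr_arg CommaMorphism.left e
    have e₂ : t.right ≫ φ'.right = φ.right ≫ w.right := congr_arg CommaMorphism.right e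
    have := ht.2
    let m : Limits.pullback a.hom φ.right ⟶ Limits.pullback a'.hom φ'.right :=
      pullback.map _ _ _ _ w.left t.right w.right (Arrow.w w).symm e₂.symm
    have hm : IsIso m := inferInstance
    refine ⟨h.corner_arrow _ _ _ _ (Arrow.w t) ht.1 ht.2 hφ.source,
      h.corner_arrow _ _ _ _ (Arrow.w w) (h.corner_isIso _ inferInstance) inferInstance hφ.target,
      h.corner_arrow _ _ _ _ e₁ ht.1 inferInstance hφ.left,
      h.corner_arrow _ _ _ _ e₂ (h.corner_isIso _ inferInstance) inferInstance hφ.right,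
      h.corner_arrow _ _ m w.left (by simp [m]) (h.corner_isIso _ inferInstance)
        inferInstance hφ.fst,
      h.corner_arrow _ _ m t.right (by simp [m]) (h.corner_isIso _ inferInstance)
        inferInstance hφ.snd,
      h.corner_arrow _ _ t.left m ?_ ht.1 inferInstance hφ.comparison⟩
    apply pullback.hom_ext
    · simp [m, e₁]
    · simp [m]
  corner_unit f := ⟨h.corner_coker (ν η f) (cokernel.π (ν η f)) (cokernel.condition _)
      ⟨cokernelIsCokernel (ν η f)⟩
      (h.corner_ker (νR η f) (η.app _) (h.corner_unit _) inferInstance (νR_η η f)),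
    inferInstanceAs (IsIso (𝟙 f.right))⟩

end Extensions

noncomputable section Stages

/-- The data available at level `k`, on a category `C` of `k`-dimensional arrows: the classes `ext`
of `k`-extensions, `extArrow` of `(k+1)`-extensions (viewed as morphisms of `C`) and `central` of
`k`-fold central extensions, and the centralisation functor `I = I_k` with its unit `η`.  Only the
stages `stage ℬ k` constructed below are used. -/
structure Stage where
  C : Type (max u v)
  [category : Category.{v} C]
  [hasZeroMorphisms : HasZeroMorphisms C]
  [hasFiniteLimits : HasFiniteLimits C]
  [hasNormalImageCokernels : HasNormalImageCokernels C]
  ext : ObjectProperty C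
  extArrow : MorphismProperty C
  central : ObjectProperty C
  I : C ⥤ C
  η : 𝟭 C ⟶ I
  lawful : ∃ (T : MorphismProperty C) (Z : ObjectProperty C), ExtensionLaws ext extArrow η T Z

attribute [instance] Stage.category Stage.hasZeroMorphisms Stage.hasFiniteLimits
  Stage.hasNormalImageCokernels

lemma isRegularEpi_comp {C : Type u} [Category.{v} C] [Regular C] {X Y W : C} (f : X ⟶ Y)
    (g : Y ⟶ W) (hf : IsRegularEpi f) (hg : IsRegularEpi g) : IsRegularEpi (f ≫ g) := by
  have : StrongEpi (f ≫ g) := strongEpi_comp f g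
  have : ExtremalEpi (f ≫ g) := inferInstance
  infer_instance

lemma extensionLaws_regularEpi {C : Type u} [Category.{v} C] [HasZeroMorphisms C]
    [PointedExactProtomodular C] {I : C ⥤ C} (η : 𝟭 C ⟶ I) :
    ExtensionLaws (⊤ : ObjectProperty C) (MorphismProperty.regularEpi C) η
      (fun _ _ _ => True) (fun _ => True) where
  src _ _ := trivial
  tgt _ _ := trivial
  zero f hX hY := by
    have : IsIso f := hX.isIso hY f
    exact (inferInstance : IsRegularEpi f)
  comp f g hf hg := isRegularEpi_comp f g hf hg
  pullback H hf _ := Regular.regularEpiIsStableUnderBaseChange.of_isPullback H hf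
  corner_isIso _ _ := trivial
  corner_ker _ _ _ _ _ := trivial
  corner_coker _ _ _ _ _ := trivial
  corner_obj _ _ _ := trivial
  corner_arrow f f' t w e _ hw hf := by
    have : IsRegularEpi f := hf
    have : StrongEpi (t ≫ f') := by
      rw [e]
      exact strongEpi_comp f w
    have : StrongEpi f' := strongEpi_of_strongEpi t f'
    have : ExtremalEpi f' := inferInstance
    exact (inferInstance : IsRegularEpi f')
  corner_unit _ := trivial

/-- Level `0`: the `0`-extensions are the objects of `𝒜`, the `1`-extensions are the regular
epimorphisms, `I₀ = I` is the reflector onto `ℬ` viewed as an endofunctor, and the unit is that of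
the adjunction. -/
def base {𝒜 : Type (max u v)} [Category.{v} 𝒜] [HasZeroMorphisms 𝒜] [PointedExactProtomodular 𝒜]
    (ℬ : ObjectProperty 𝒜) [Reflective ℬ.ι] : Stage.{v, u} where
  C := 𝒜
  ext := ⊤
  extArrow := MorphismProperty.regularEpi 𝒜
  central := ℬ
  I := reflector ℬ.ι ⋙ ℬ.ι
  η := (reflectorAdjunction ℬ.ι).unit
  lawful := ⟨_, _, extensionLaws_regularEpi _⟩

/-- The passage from level `k` to level `k+1`: a `(k+1)`-extension is an arrow in `extArrow`, a
`(k+2)`-extension is a double extension, a `(k+1)`-fold central extension is a central extension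
with respect to the Galois structure of level `k`, and `I_{k+1} = (I_k)₁`. -/
def Stage.next (S : Stage.{v, u}) : Stage.{v, u} where
  C := Arrow S.C
  ext := fun f => S.extArrow f.hom
  extArrow := doubleExtension S.extArrow
  central := IsCentralExtension S.extArrow S.η
  I := I₁ S.η
  η := η₁ S.η
  lawful := by
    obtain ⟨T, Z, h⟩ := S.lawful
    exact ⟨_, _, h.next⟩

/-- Level `k`. -/
def stage {𝒜 : Type (max u v)} [Category.{v} 𝒜] [HasZeroMorphisms 𝒜] [PointedExactProtomodular 𝒜]
    (ℬ : ObjectProperty 𝒜) [Reflective ℬ.ι] : ℕ → Stage.{v, u}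
  | 0 => base ℬ
  | k + 1 => (stage ℬ k).next

namespace Stage

/-- The level which is `n` steps above `S`. -/
def up : Stage.{v, u} → ℕ → Stage.{v, u}
  | S, 0 => S
  | S, n + 1 => up S.next n

/-- The level which is `n` steps above level `k` is level `k + n`. -/
lemma up_stage {𝒜 : Type (max u v)} [Category.{v} 𝒜] [HasZeroMorphisms 𝒜]
    [PointedExactProtomodular 𝒜] (ℬ : ObjectProperty 𝒜) [Reflective ℬ.ι] (k n : ℕ) :
    (stage ℬ k).up n = stage ℬ (k + n) := by
  induction n generalizing k with
  | zero => rfl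
  | succ n ih => exact (ih (k + 1)).trans (by rw [Nat.add_right_comm, Nat.add_assoc])

variable (S : Stage.{v, u})

/-- The category of `k`-extensions, a full subcategory of the category of `k`-dimensional
arrows. -/
abbrev Ext : Type (max u v) := S.ext.FullSubcategory

/-- The functor `I_k`, on the category of `k`-extensions. -/
def IExt : S.Ext ⥤ S.Ext :=
  S.ext.lift (S.ext.ι ⋙ S.I) (fun X => by
    obtain ⟨T, Z, h⟩ := S.lawful
    exact h.ext_obj X.property)

/-- The unit of `I_k`, on the category of `k`-extensions. -/
def ηExt : 𝟭 S.Ext ⟶ S.IExt where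
  app X := ObjectProperty.homMk (S.η.app X.obj)
  naturality _ _ f := ObjectProperty.hom_ext _ (S.η.naturality f.hom)

/-- The functor `cod` from `(k+1)`-extensions to `k`-extensions. -/
def cod : S.next.Ext ⥤ S.Ext :=
  S.ext.lift (S.next.ext.ι ⋙ (Arrow.rightFunc : Arrow S.C ⥤ S.C)) (fun f => by
    obtain ⟨T, Z, h⟩ := S.lawful
    exact h.tgt _ f.property)

/-- The kernel functor on arrows. -/
def kerArrow (C : Type u) [Category.{v} C] [HasZeroMorphisms C] [HasFiniteLimits C] :
    Arrow C ⥤ C where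
  obj f := kernel f.hom
  map {f g} φ := kernel.map f.hom g.hom φ.left φ.right (Arrow.w φ).symm
  map_id f := by
    rw [← cancel_mono (kernel.ι f.hom)]
    simp
  map_comp φ ψ := by
    rw [← cancel_mono (kernel.ι _)]
    simp

/-- The functor `ker` from `(k+1)`-extensions to `k`-extensions. -/
def ker : S.next.Ext ⥤ S.Ext :=
  S.ext.lift (S.next.ext.ι ⋙ kerArrow S.C) (fun f => by
    obtain ⟨T, Z, h⟩ := S.lawful
    exact h.kernel _ f.property)

/-- The functor `codⁿ` from `(k+n)`-extensions to `k`-extensions. -/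
def codN : ∀ (S : Stage.{v, u}) (n : ℕ), (S.up n).Ext ⥤ S.Ext
  | S, 0 => 𝟭 S.Ext
  | S, n + 1 => codN S.next n ⋙ S.cod

/-- The functor `kerⁿ` from `(k+n)`-extensions to `k`-extensions. -/
def kerN : ∀ (S : Stage.{v, u}) (n : ℕ), (S.up n).Ext ⥤ S.Ext
  | S, 0 => 𝟭 S.Ext
  | S, n + 1 => kerN S.next n ⋙ S.ker

/-- The functor `kerⁿ ∘ I_{k+n}`. -/
abbrev kerI (n : ℕ) : (S.up n).Ext ⥤ S.Ext := (S.up n).IExt ⋙ S.kerN n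

variable {S}

/-- The composite `∂ = (ker ∂') ∘ δ_{codⁿ}`. -/
def connect {n : ℕ} {H' : S.next.Ext ⥤ S.next.Ext} (d : S.next.codN n ⋙ H' ⟶ S.next.kerI n)
    {H : S.Ext ⥤ S.Ext} (δ : S.cod ⋙ H ⟶ H' ⋙ S.ker) : S.codN (n + 1) ⋙ H ⟶ S.kerI (n + 1) :=
  (Functor.whiskerLeft (S.next.codN n) δ ≫ Functor.whiskerRight d S.ker :
    S.next.codN n ⋙ S.cod ⋙ H ⟶ S.next.kerI n ⋙ S.ker)

/-- `IsHomologyFunctor n S H ∂`, for `S` at level `k`, says that `H` is the homology functor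
`H_{n+1}(-,I_k)`, with induced natural transformation `∂` from `H ∘ codⁿ` to `kerⁿ ∘ I_{k+n}`:
`H₁(-,I_k)` is `I_k`, and `H_{n+2}(-,I_k)`, with connecting transformation `δ`, is a pointwise right
Kan extension of `ker ∘ H_{n+1}(-,I_{k+1})` along `cod`. -/
inductive IsHomologyFunctor : ∀ (n : ℕ) (S : Stage.{v, u}) (H : S.Ext ⥤ S.Ext)
    (_ : S.codN n ⋙ H ⟶ S.kerI n), Prop
  | zero (S : Stage.{v, u}) : IsHomologyFunctor 0 S S.IExt (𝟙 S.IExt)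
  | succ (n : ℕ) (S : Stage.{v, u}) (H' : S.next.Ext ⥤ S.next.Ext)
      (d : S.next.codN n ⋙ H' ⟶ S.next.kerI n) (H : S.Ext ⥤ S.Ext)
      (δ : S.cod ⋙ H ⟶ H' ⋙ S.ker) :
      IsHomologyFunctor n S.next H' d →
      Nonempty (Functor.RightExtension.mk H δ).IsPointwiseRightKanExtension →
      IsHomologyFunctor (n + 1) S H (connect d δ)

/-- The diagram `kerⁿ ∘ I_{k+n} ∘ U` on the comma category `(A ↓ codⁿ)`. -/
abbrev commaDiagram (n : ℕ) (A : S.Ext) : StructuredArrow A (S.codN n) ⥤ S.Ext :=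
  StructuredArrow.proj A (S.codN n) ⋙ S.kerI n

lemma comp_map_eq {C D : Type*} [Category C] [Category D] (K : C ⥤ D) {W : D} {M N M' N' : C}
    {p : W ⟶ K.obj M} {q : W ⟶ K.obj N} {h : M ⟶ N} {d : M ⟶ M'} {d' : N ⟶ N'} {g : M' ⟶ N'}
    (h₁ : p ≫ K.map h = q) (h₂ : h ≫ d' = d ≫ g) :
    q ≫ K.map d' = (p ≫ K.map d) ≫ K.map g := by
  rw [Category.assoc, ← K.map_comp, ← h₂, ← h₁, K.map_comp, Category.assoc]

/-- A cone on `ker ∘ H' ∘ U : (A ↓ cod) ⥤ Ext` induces a cone on `kerⁿ⁺¹ ∘ I_{k+n+1} ∘ U`. -/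
def connectCone {n : ℕ} {H' : S.next.Ext ⥤ S.next.Ext} (d : S.next.codN n ⋙ H' ⟶ S.next.kerI n)
    {A : S.Ext} (c : Cone (StructuredArrow.proj A S.cod ⋙ H' ⋙ S.ker)) :
    Cone (commaDiagram (n + 1) A) where
  pt := c.pt
  π :=
    { app := fun x => c.π.app
        (StructuredArrow.mk (S := A) (T := S.cod) (Y := (S.next.codN n).obj x.right) x.hom) ≫
          S.ker.map (d.app x.right)
      naturality := fun x y f => by
        let X : (S.next.up n).Ext := x.right
        let Y : (S.next.up n).Ext := y.right
        let g : X ⟶ Y := f.right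
        let x' := StructuredArrow.mk (S := A) (T := S.cod) (Y := (S.next.codN n).obj X) x.hom
        let y' := StructuredArrow.mk (S := A) (T := S.cod) (Y := (S.next.codN n).obj Y) y.hom
        let f' : x' ⟶ y' := StructuredArrow.homMk ((S.next.codN n).map g) (StructuredArrow.w f)
        have h₁ : c.π.app x' ≫ S.ker.map (H'.map ((S.next.codN n).map g)) = c.π.app y' := c.w f'
        have h₂ : H'.map ((S.next.codN n).map g) ≫ d.app Y = d.app X ≫ (S.next.kerI n).map g :=
          d.naturality g
        exact (Category.id_comp _).trans (comp_map_eq S.ker h₁ h₂) }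

/-- `IsHomologyCone n A s` says that the object `H_{n+1}(A,I_k)` exists and is the vertex of the
cone `s` on `kerⁿ ∘ I_{k+n} ∘ U : (A ↓ codⁿ) ⥤ Ext`, in one of the following senses: the homology
functor `H_{n+1}(-,I_k)` exists and `s` is its value at `A`; or `H_n(-,I_{k+1})` exists, and so does
the limit at `A` which would define the pointwise Kan extension; or `s` is a limit cone. -/
inductive IsHomologyCone : ∀ {S : Stage.{v, u}} (n : ℕ) (A : S.Ext) (_ : Cone (commaDiagram n A)),
    Prop
  | functor {S : Stage.{v, u}} (n : ℕ) (A : S.Ext) (H : S.Ext ⥤ S.Ext)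
      (d : S.codN n ⋙ H ⟶ S.kerI n) :
      IsHomologyFunctor n S H d →
      IsHomologyCone n A ((Functor.RightExtension.mk H d).coneAt A)
  | object {S : Stage.{v, u}} (n : ℕ) (A : S.Ext) (H' : S.next.Ext ⥤ S.next.Ext)
      (d : S.next.codN n ⋙ H' ⟶ S.next.kerI n)
      (c : Cone (StructuredArrow.proj A S.cod ⋙ H' ⋙ S.ker)) :
      IsHomologyFunctor n S.next H' d → Nonempty (IsLimit c) →
      IsHomologyCone (n + 1) A (connectCone d c)
  | limit {S : Stage.{v, u}} (n : ℕ) (A : S.Ext) (s : Cone (commaDiagram n A)) :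
      Nonempty (IsLimit s) → IsHomologyCone n A s

/-- The category of `n`-extensions of `A`: the preimage of `1_A` under `codⁿ`. -/
abbrev ExtOver (n : ℕ) (A : S.Ext) : Type (max u v) := Functor.Fiber (S.codN n) A

/-- The inclusion of the `n`-extensions of `A` into the `(k+n)`-extensions. -/
abbrev extInclusion (n : ℕ) (A : S.Ext) : ExtOver n A ⥤ (S.up n).Ext :=
  Functor.Fiber.fiberInclusion

/-- The functor sending an `n`-extension `f` of `A` to `(f, 1_A)`. -/
def toComma (n : ℕ) (A : S.Ext) : ExtOver n A ⥤ StructuredArrow A (S.codN n) where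
  obj f := StructuredArrow.mk (Y := f.1) (eqToHom f.2.symm)
  map {f g} φ := StructuredArrow.homMk φ.1 (by
    have := φ.2
    simp [IsHomLift.fac' (S.codN n) (𝟙 A) φ.1])
  map_id f := rfl
  map_comp φ ψ := rfl

/-- The diagram `kerⁿ ∘ I_{k+n}` on the category of `n`-extensions of `A`. -/
abbrev extDiagram (n : ℕ) (A : S.Ext) : ExtOver n A ⥤ S.Ext := extInclusion n A ⋙ S.kerI n

/-- The cone on `kerⁿ ∘ I_{k+n} : Ext_A ⥤ Ext` obtained by restriction along `f ↦ (f, 1_A)`. -/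
def extCone {n : ℕ} {A : S.Ext} (s : Cone (commaDiagram n A)) : Cone (extDiagram n A) :=
  s.whisker (toComma n A)

/-- The central `n`-extensions of `A`. -/
def isCentralOver (n : ℕ) (A : S.Ext) : ObjectProperty (ExtOver n A) :=
  fun f => (S.up n).central f.1.obj

/-- The category of central `n`-extensions of `A`, a full subcategory of the category of
`n`-extensions of `A`. -/
abbrev CExtOver (n : ℕ) (A : S.Ext) : Type (max u v) := (isCentralOver n A).FullSubcategory

/-- The inclusion of the central `n`-extensions of `A` into the `n`-extensions of `A`. -/
abbrev centralInclusion (n : ℕ) (A : S.Ext) : CExtOver n A ⥤ ExtOver n A := (isCentralOver n A).ι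

/-- The diagram `kerⁿ` on the category of central `n`-extensions of `A`. -/
abbrev centralDiagram (n : ℕ) (A : S.Ext) : CExtOver n A ⥤ S.Ext :=
  centralInclusion n A ⋙ extInclusion n A ⋙ S.kerN n

/-- The natural transformation with components `kerⁿ η_f : kerⁿ f ⟶ kerⁿ (I_{k+n} f)`, on the
category of central `n`-extensions of `A`. -/
def centralUnit (n : ℕ) (A : S.Ext) :
    centralDiagram n A ⟶ centralInclusion n A ⋙ extDiagram n A :=
  Functor.whiskerLeft (centralInclusion n A ⋙ extInclusion n A)
    (Functor.whiskerRight (S.up n).ηExt (S.kerN n) : S.kerN n ⟶ S.kerI n)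

end Stage

/-- Birkhoff subcategories: the reflective subcategories that are closed under subobjects and
regular quotients. -/
structure IsBirkhoff {C : Type u} [Category.{v} C] (P : ObjectProperty C) : Prop where
  subobject : ∀ {X Y : C} (m : X ⟶ Y), Mono m → P Y → P X
  quotient : ∀ {X Y : C} (q : X ⟶ Y), IsRegularEpi q → P X → P Y

end Stages

end Satellite

/-! Whichever sense of existence is used, $H_{n+1}(A,I_k)$ is the vertex of a limit cone over
$(A\downarrow\mathrm{cod}^n)$. For the Kan extensions this is an induction on $n$: the kernel
functor is right adjoint to $X\mapsto(X\to 0)$, hence preserves the limits computing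
$H_n(-,I_{k+1})$, and a limit over $(A\downarrow\mathrm{cod})$ of such limits is a single limit over
the larger comma category (`existsUnique_lift_structuredArrow`).

For part 1, extensions can be pulled back. An object $(f,g)$ of $(A\downarrow\mathrm{cod}^n)$
therefore receives a morphism from $(g^*f,1_A)$, through which every other morphism from an
$n$-extension of $A$ factors. So $f\mapsto(f,1_A)$ is an initial functor (`initial_toComma`), and
restricting along it preserves limits.

For part 2, the unit $\eta^{k+n}$ is a morphism of $n$-extensions of $A$ that $I_{k+n}$ inverts, and
its codomain is central. The limit in 1 can then be computed on central extensions alone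
(`isLimit_whisker_of_reflection`), where the unit is invertible, so that $\ker^n\eta$ identifies the
two diagrams.

The algebra lies in showing that centralisations are central and that central extensions have an
invertible unit. Both come from a criterion: an extension $f$ is central exactly when $J_1[f]=0$.
The key is that $J_1$ sends double extensions to extensions (`ext_J₁map`). Vanishing of $J_1$ thus
passes from a trivial pullback of $f$ to $f$ itself; moreover $J_1(\eta^1_f)$ is both zero and an
extension, so $J_1$ vanishes on $I_1f$. Conversely, if $J_1[f]=0$ then $J\pi_2$ is invertible and
$\pi_2$, the pullback of $f$ along itself, is trivial.

These arguments use only the properties listed in `CentralisationLaws`. They hold at level 0 by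
exactness, protomodularity and the Birkhoff condition, and pass to arrows
(`CentralisationLaws.next`), hence hold at every level. -/

namespace Satellite

attribute [local simp] pullback.lift_fst pullback.lift_snd pullback.lift_fst_assoc
  pullback.lift_snd_assoc prod.lift_fst prod.lift_snd prod.lift_fst_assoc prod.lift_snd_assoc

/-! ### Regular epimorphisms and kernels in an exact protomodular category -/

section ExactFacts

lemma isIso_of_mono_of_isRegularEpi {C : Type u} [Category.{v} C] {X Y : C} (f : X ⟶ Y) [Mono f]
    (h : IsRegularEpi f) : IsIso f :=
  isIso_of_mono_of_strongEpi f

variable {C : Type u} [Category.{v} C] [HasZeroMorphisms C] [PointedExactProtomodular C]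

lemma isRegularEpi_of_strongEpi {X Y : C} (f : X ⟶ Y) [StrongEpi f] : IsRegularEpi f := by
  have : ExtremalEpi f := inferInstance
  infer_instance

/-- Generalised elements lift along regular epimorphisms after a cover. -/
lemma exists_cover {X Y W : C} (f : X ⟶ Y) [IsRegularEpi f] (y : W ⟶ Y) :
    ∃ (V : C) (ρ : V ⟶ W) (x : V ⟶ X), IsRegularEpi ρ ∧ x ≫ f = ρ ≫ y :=
  ⟨_, pullback.snd f y, pullback.fst f y, inferInstance, pullback.condition⟩

lemma exists_image {X Y : C} (f : X ⟶ Y) :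
    ∃ (M : C) (e : X ⟶ M) (m : M ⟶ Y), IsRegularEpi e ∧ Mono m ∧ e ≫ m = f :=
  ⟨_, (Regular.strongEpiMonoFactorisation f).e, (Regular.strongEpiMonoFactorisation f).m,
    inferInstance, inferInstance, (Regular.strongEpiMonoFactorisation f).fac⟩

lemma isRegularEpi_of_comp {X Y W : C} (f : X ⟶ Y) (g : Y ⟶ W) (h : IsRegularEpi (f ≫ g)) :
    IsRegularEpi g := by
  have : StrongEpi g := strongEpi_of_strongEpi f g
  exact isRegularEpi_of_strongEpi g

lemma exists_desc {X Y W : C} (f : X ⟶ Y) (k : X ⟶ W) [IsRegularEpi f]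
    (w : pullback.fst f f ≫ k = pullback.snd f f ≫ k) : ∃ d, f ≫ d = k :=
  have H : IsKernelPair f _ _ := IsPullback.of_hasPullback f f
  ⟨_, (Cofork.IsColimit.desc' H.toCoequalizer' k w).2⟩

/-- Relations between two objects are difunctional. -/
lemma difunctional_of_relation {T X Y : C} (d₀ : T ⟶ X) (d₁ : T ⟶ Y) [JointlyMono₂ d₀ d₁] {W : C}
    (t₁ t₂ t₃ : W ⟶ T) (h₁ : t₁ ≫ d₁ = t₂ ≫ d₁) (h₂ : t₂ ≫ d₀ = t₃ ≫ d₀) :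
    ∃ t : W ⟶ T, t ≫ d₀ = t₁ ≫ d₀ ∧ t ≫ d₁ = t₃ ≫ d₁ := by
  -- The inclusions of `X` and `Y` into `X ⨯ Y` turn the relation into one on a single object.
  have : JointlyMono₂ (d₀ ≫ prod.lift (𝟙 X) (0 : X ⟶ Y)) (d₁ ≫ prod.lift (0 : Y ⟶ X) (𝟙 Y)) :=
    ⟨fun _ x y h h' => JointlyMono₂.right_cancellation (p₁ := d₀) (p₂ := d₁) x y
      (by simpa using congr($h ≫ prod.fst)) (by simpa using congr($h' ≫ prod.snd))⟩
  obtain ⟨t, ht₁, ht₂⟩ := difunctional (d₀ ≫ prod.lift (𝟙 X) (0 : X ⟶ Y))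
    (d₁ ≫ prod.lift (0 : Y ⟶ X) (𝟙 Y)) t₁ t₂ t₃ (by rw [reassoc_of% h₁]) (by rw [reassoc_of% h₂])
  exact ⟨t, by simpa using congr($ht₁ ≫ prod.fst), by simpa using congr($ht₂ ≫ prod.snd)⟩

/-- A square of split epimorphisms whose remaining sides are regular epimorphisms is a regular
pushout. -/
lemma isRegularEpi_comparison {X X' B B' : C} {p : X ⟶ B} {s : B ⟶ X} {p' : X' ⟶ B'}
    {s' : B' ⟶ X'} {x : X ⟶ X'} {b : B ⟶ B'} (hs : s ≫ p = 𝟙 B)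
    (w : p ≫ b = x ≫ p') (ws : s ≫ x = b ≫ s') (hx : IsRegularEpi x)
    {P : C} {q : P ⟶ X'} {r : P ⟶ B} (H : IsPullback q r p' b) (c : X ⟶ P) (h₁ : c ≫ q = x)
    (h₂ : c ≫ r = p) : IsRegularEpi c := by
  obtain ⟨M, e, m, he, hm, rfl⟩ := exists_image c
  have : JointlyMono₂ (m ≫ q) (m ≫ r) := ⟨fun _ y z h h' => by
    rw [← cancel_mono m]
    apply H.hom_ext
    · simpa using h
    · simpa using h'⟩
  obtain ⟨V, ρ, θ, hρ, hθ⟩ := exists_cover x q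
  simp only [Category.assoc] at h₁ h₂
  -- In elements, let `(x', b₀)` be in `P` and `x θ = x'`. The relation `M` contains `(xθ, pθ)`,
  -- `(xspθ, pθ)` and `(xs b₀, b₀)`; the last two share their first entry because `xs = s'b` and
  -- `p'x' = b b₀`. Difunctionality gives `(x', b₀)` in `M`.
  obtain ⟨t, ht₀, ht₁⟩ := difunctional_of_relation (m ≫ q) (m ≫ r) (θ ≫ e) (θ ≫ p ≫ s ≫ e)
    (ρ ≫ r ≫ s ≫ e) (by simp [h₂, hs]) (by
      simp only [Category.assoc, h₁, ws]
      rw [reassoc_of% w, reassoc_of% hθ, ← reassoc_of% H.w])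
  simp only [Category.assoc, h₁, h₂, hs, Category.comp_id] at ht₀ ht₁
  have htm : t ≫ m = ρ := by
    apply H.hom_ext
    · simpa [hθ] using ht₀
    · simpa using ht₁
  have : IsIso m := isIso_of_mono_of_isRegularEpi m (isRegularEpi_of_comp t m (htm ▸ hρ))
  exact isRegularEpi_comp e m he inferInstance

/-- Morphisms with zero kernel are monic. -/
lemma mono_of_zero_kernel {X Y : C} (f : X ⟶ Y)
    (h : ∀ {W : C} (x : W ⟶ X), x ≫ f = 0 → x = 0) : Mono f := by
  have hk : kernel.ι (pullback.fst f f) = 0 := by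
    apply pullback.hom_ext
    · simp
    · rw [zero_comp]
      apply h
      rw [Category.assoc, ← pullback.condition, kernel.condition_assoc, zero_comp]
  have : IsIso (pullback.lift (𝟙 X) (𝟙 X) rfl : X ⟶ pullback f f) :=
    have : Mono (pullback.lift (𝟙 X) (𝟙 X) rfl : X ⟶ pullback f f) :=
      mono_of_mono_fac (pullback.lift_fst _ _ _)
    isIso_of_kernel_section (pullback.fst f f) (pullback.lift (𝟙 X) (𝟙 X) rfl) (by simp) _ 0
      (by simp [hk]) (𝟙 X) (by simp)
  have e : pullback.fst f f = pullback.snd f f := by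
    rw [← cancel_epi (pullback.lift (𝟙 X) (𝟙 X) rfl : X ⟶ pullback f f)]
    simp
  exact ⟨fun x y hxy => by simpa using congr(pullback.lift x y hxy ≫ $e)⟩

/-- The Short Five Lemma for regular epimorphisms. -/
lemma isIso_of_lift_kernel {X Y A : C} (f : X ⟶ A) (g : Y ⟶ A) (t : X ⟶ Y) (hf : IsRegularEpi f)
    (w : t ≫ g = f) [Mono t]
    (h : ∀ {W : C} (y : W ⟶ Y), y ≫ g = 0 → ∃ x, x ≫ t = y) : IsIso t := by
  -- Both pullbacks are split over `X` by their first projections, and their kernels are those of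
  -- `f` and `g`. Once `m` is invertible, the base change of `f` along `g` factors through `t`, so
  -- `t` is a regular epimorphism.
  let m : pullback f f ⟶ pullback f g :=
    pullback.lift (pullback.fst f f) (pullback.snd f f ≫ t) (by
      rw [Category.assoc, w, pullback.condition])
  have : Mono m := ⟨fun x y e => by
    apply pullback.hom_ext
    · simpa [m] using congr($e ≫ pullback.fst f g)
    · rw [← cancel_mono t]
      simpa [m] using congr($e ≫ pullback.snd f g)⟩
  obtain ⟨z, hz⟩ := h (kernel.ι (pullback.fst f g) ≫ pullback.snd f g) (by
    rw [Category.assoc, ← pullback.condition, kernel.condition_assoc, zero_comp])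
  have : IsIso m := isIso_of_kernel_section (pullback.fst f g)
    (pullback.lift (𝟙 X) t (by simp [w])) (by simp) m
    (pullback.lift 0 z (by
      have := congr(kernel.ι (pullback.fst f g) ≫ $(pullback.condition (f := f) (g := g)))
      simpa [w, ← reassoc_of% hz] using this))
    (by apply pullback.hom_ext <;> simp [m, hz]) (pullback.lift (𝟙 X) (𝟙 X) rfl)
    (by apply pullback.hom_ext <;> simp [m])
  have e : (inv m ≫ pullback.snd f f) ≫ t = pullback.snd f g := by
    rw [← cancel_epi m]
    simp [m]
  exact isIso_of_mono_of_isRegularEpi t (isRegularEpi_of_comp _ t (by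
    rw [e]
    infer_instance))

/-- Direct images of kernels along regular epimorphisms are kernels. -/
lemma exists_direct_image {R Q B : C} (g : R ⟶ Q) (π : R ⟶ B) (hπ : IsRegularEpi π) :
    ∃ (Y : C) (c : B ⟶ Y), IsRegularEpi c ∧
      pullback.fst g g ≫ π ≫ c = pullback.snd g g ≫ π ≫ c ∧
      ∀ {X : C} (x : X ⟶ B), x ≫ c = 0 →
        ∃ (V : C) (ρ : V ⟶ X) (y : V ⟶ R), IsRegularEpi ρ ∧ y ≫ g = 0 ∧ y ≫ π = ρ ≫ x := by
  -- `T` is the image in `B ⨯ B` of the kernel pair of `g`. It is reflexive because `π` is a regular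
  -- epimorphism, hence it is the kernel pair of its coequalizer `c`.
  obtain ⟨T, e, m, he, hm, fac⟩ := exists_image
    (prod.lift (pullback.fst g g ≫ π) (pullback.snd g g ≫ π))
  have h₀ : e ≫ m ≫ prod.fst = pullback.fst g g ≫ π := by rw [← Category.assoc, fac]; simp
  have h₁ : e ≫ m ≫ prod.snd = pullback.snd g g ≫ π := by rw [← Category.assoc, fac]; simp
  have : JointlyMono₂ (m ≫ prod.fst) (m ≫ prod.snd) := ⟨fun _ x y h h' => by
    rw [← cancel_mono m]
    ext
    · simpa using h
    · simpa using h'⟩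
  have sq : CommSq ((pullback.lift (𝟙 R) (𝟙 R) rfl : R ⟶ pullback g g) ≫ e) π m
      (prod.lift (𝟙 B) (𝟙 B)) := ⟨by rw [Category.assoc, fac]; ext <;> simp⟩
  have hr₀ : sq.lift ≫ m ≫ prod.fst = 𝟙 B := by simp
  have hr₁ : sq.lift ≫ m ≫ prod.snd = 𝟙 B := by simp
  obtain ⟨Y', q, hq⟩ := PointedExactProtomodular.effective _ _
    (isEquivalenceRelation_of_reflexive (m ≫ prod.fst) (m ≫ prod.snd) sq.lift hr₀ hr₁)
  have := Regular.hasCoequalizer_of_isKernelPair hq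
  let c := coequalizer.π (m ≫ prod.fst) (m ≫ prod.snd)
  have hc : IsKernelPair c (m ≫ prod.fst) (m ≫ prod.snd) := by
    have hcq : c ≫ coequalizer.desc q hq.w = q := coequalizer.π_desc _ _
    exact IsKernelPair.cancel_right (coequalizer.condition _ _) (by rwa [hcq])
  refine ⟨_, c, inferInstance, ?_, fun {X} x hx => ?_⟩
  · rw [← reassoc_of% h₀, ← reassoc_of% h₁]
    simpa using congr(e ≫ $(coequalizer.condition (m ≫ prod.fst) (m ≫ prod.snd)))
  · have H := IsPullback.of_hasPullback (m ≫ prod.fst) π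
    -- An element `x` of the kernel of `c` gives the pair `(0, x)` in `T`. Surjectivity onto the
    -- pullback lets this pair be lifted to the kernel pair of `g` with first entry exactly 0; the
    -- second entry is then in the kernel of `g`.
    have hcomp := isRegularEpi_comparison (p := pullback.fst g g)
      (s := pullback.lift (𝟙 R) (𝟙 R) rfl) (p' := m ≫ prod.fst) (s' := sq.lift) (x := e) (b := π)
      (by simp) h₀.symm sq.fac_left.symm he H
      (pullback.lift e (pullback.fst g g) h₀) (by simp) (by simp)
    let t : X ⟶ T := hc.lift 0 x (by simp [hx])
    obtain ⟨V, ρ, y, hρ, hy⟩ := exists_cover (pullback.lift e (pullback.fst g g) h₀)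
      (pullback.lift t (0 : X ⟶ R) (by
        rw [zero_comp]
        exact hc.lift_fst _ _ _))
    have hy₀ : y ≫ pullback.fst g g = 0 := by simpa using congr($hy ≫ pullback.snd _ _)
    have hy₁ : y ≫ e = ρ ≫ t := by simpa using congr($hy ≫ pullback.fst _ _)
    refine ⟨V, ρ, y ≫ pullback.snd g g, hρ, ?_, ?_⟩
    · rw [Category.assoc, ← pullback.condition, reassoc_of% hy₀, zero_comp]
    · rw [Category.assoc, ← h₁, reassoc_of% hy₁]
      congr 1
      exact hc.lift_snd _ _ _

end ExactFacts

/-! ### The laws behind centralisation, and preservation of extensions by `J₁` -/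

noncomputable section CentralisationLaws

variable {C : Type u} [Category.{v} C]

lemma isPullback_of_elements {P X Y W : C} {p : P ⟶ X} {q : P ⟶ Y} {f : X ⟶ W} {g : Y ⟶ W}
    (w : p ≫ f = q ≫ g)
    (ex : ∀ {V : C} (x : V ⟶ X) (y : V ⟶ Y), x ≫ f = y ≫ g → ∃ z, z ≫ p = x ∧ z ≫ q = y)
    (uniq : ∀ {V : C} (z z' : V ⟶ P), z ≫ p = z' ≫ p → z ≫ q = z' ≫ q → z = z') :
    IsPullback p q f g :=
  ⟨⟨w⟩, ⟨PullbackCone.IsLimit.mk _ (fun c => (ex _ _ c.condition).choose)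
    (fun c => (ex _ _ c.condition).choose_spec.1) (fun c => (ex _ _ c.condition).choose_spec.2)
    (fun c _ h₁ h₂ => uniq _ _ (h₁.trans (ex _ _ c.condition).choose_spec.1.symm)
      (h₂.trans (ex _ _ c.condition).choose_spec.2.symm))⟩⟩

/-- The facts on extensions and on `I` from which it follows that the centralisation of an extension
is its reflection into the central extensions.  They hold at level `0`, and are inherited by the
category of arrows. -/
structure CentralisationLaws [HasZeroMorphisms C] [HasFiniteLimits C] (O : ObjectProperty C)
    (E : MorphismProperty C) {I : C ⥤ C} (η : 𝟭 C ⟶ I) (T : MorphismProperty C)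
    (Z : ObjectProperty C) : Prop extends ExtensionLaws O E η T Z where
  corner_ext : ∀ {X Y : C} (t : X ⟶ Y), T t → O X → E t
  cancel : ∀ {X Y W : C} (f : X ⟶ Y) (g : Y ⟶ W), E f → E (f ≫ g) → E g
  to_zero : ∀ {X Y : C} (f : X ⟶ Y), O X → IsZero Y → E f
  comparison : ∀ {X X' B B' P : C} {p : X ⟶ B} {s : B ⟶ X} {p' : X' ⟶ B'} {s' : B' ⟶ X'}
    {x : X ⟶ X'} {b : B ⟶ B'} {q : P ⟶ X'} {r : P ⟶ B} (c : X ⟶ P), s ≫ p = 𝟙 B →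
    s' ≫ p' = 𝟙 B' → p ≫ b = x ≫ p' → s ≫ x = b ≫ s' → E p → E p' → E x → E b →
    IsPullback q r p' b → c ≫ q = x → c ≫ r = p → E c
  mono : ∀ {X Y : C} (f : X ⟶ Y), (∀ {W : C} (x : W ⟶ X), x ≫ f = 0 → x = 0) → Mono f
  five : ∀ {X Y A : C} (f : X ⟶ A) (g : Y ⟶ A) (t : X ⟶ Y), E f → t ≫ g = f → Mono t →
    (∀ {W : C} (y : W ⟶ Y), y ≫ g = 0 → ∃ x, x ≫ t = y) → IsIso t
  -- The condition on `x` says that it lies in the kernel of the cokernel of `n ≫ π`, phrased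
  -- without choosing a cokernel so that it can be tested on each component of an arrow.
  normal : ∀ {N R Q B : C} (n : N ⟶ R) (g : R ⟶ Q) (π : R ⟶ B) (s : B ⟶ R), Mono (n ≫ π) →
    n ≫ g = 0 → (∀ {X : C} (x : X ⟶ R), x ≫ g = 0 → ∃ y, y ≫ n = x) → s ≫ π = 𝟙 B →
    ∀ {X : C} (x : X ⟶ B), (∀ {Z : C} (z : B ⟶ Z), (n ≫ π) ≫ z = 0 → x ≫ z = 0) →
      ∃ y, y ≫ n ≫ π = x
  J_ext : ∀ {X Y : C} (f : X ⟶ Y), E f → E ((J η).map f)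

namespace CentralisationLaws

variable [HasZeroMorphisms C] [HasFiniteLimits C]
  {O : ObjectProperty C} {E : MorphismProperty C} {I : C ⥤ C} {η : 𝟭 C ⟶ I}
  {T : MorphismProperty C} {Z : ObjectProperty C}

lemma ext_of_isIso (h : CentralisationLaws O E η T Z) {X Y : C} (t : X ⟶ Y) [IsIso t]
    (hX : O X) : E t :=
  h.corner_ext t (h.corner_isIso t inferInstance) hX

lemma isIso_of_mono (h : CentralisationLaws O E η T Z) {X Y : C} (f : X ⟶ Y) [Mono f]
    (hf : E f) : IsIso f :=
  h.five f (𝟙 Y) f hf (Category.comp_id f) inferInstance (fun y hy => by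
    rw [Category.comp_id] at hy
    exact ⟨0, by rw [hy, zero_comp]⟩)

lemma isZero_of_isZero (h : CentralisationLaws O E η T Z) {X Y : C} (f : X ⟶ Y) (hf : E f)
    (hX : IsZero X) : IsZero Y := by
  have : Mono f := ⟨fun _ _ _ => hX.eq_of_tgt _ _⟩
  have := h.isIso_of_mono f hf
  exact hX.of_iso (asIso f).symm

/-- A zero extension factors through the zero object, so right cancellation makes `0 ⟶ Y` an
extension; being monic, it is invertible. -/
lemma isZero_of_ext_zero (h : CentralisationLaws O E η T Z) {X Y : C} (hf : E (0 : X ⟶ Y)) :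
    IsZero Y := by
  refine h.isZero_of_isZero (0 : ⊤_ C ⟶ Y) (h.cancel (0 : X ⟶ ⊤_ C) _
    (h.to_zero _ (h.src _ hf) isZero_top) ?_) isZero_top
  rwa [zero_comp]

lemma ext_pullback (h : CentralisationLaws O E η T Z) {b a : Arrow C} {φ : b ⟶ a}
    (hφ : doubleExtension E φ) {P : C} {q : P ⟶ a.left} {r : P ⟶ b.right}
    (H : IsPullback q r a.hom φ.right) (c : b.left ⟶ P) (h₁ : c ≫ q = φ.left)
    (h₂ : c ≫ r = b.hom) : E c := by
  have e : pullback.lift φ.left b.hom (Arrow.w φ) ≫ H.isoPullback.inv = c := by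
    apply H.hom_ext
    · simp [h₁]
    · simp [h₂]
  rw [← e]
  exact h.comp _ _ hφ.comparison (h.ext_of_isIso _ (h.tgt _ hφ.comparison))

/-- Stability under base change and composition supplies the remaining edges once two adjacent edges
and the comparison are extensions. Any pullback may replace the chosen one. -/
lemma doubleExtension_of_isPullback (h : CentralisationLaws O E η T Z) {b a : Arrow C} {φ : b ⟶ a}
    {P : C} {q : P ⟶ a.left} {r : P ⟶ b.right} (H : IsPullback q r a.hom φ.right)
    (c : b.left ⟶ P) (h₁ : c ≫ q = φ.left) (h₂ : c ≫ r = b.hom) (ha : E a.hom)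
    (hr : E φ.right) (hc : E c) : doubleExtension E φ := by
  have hP := IsPullback.of_hasPullback a.hom φ.right
  have hfst := h.pullback hP.flip hr (h.src _ ha)
  have hsnd := h.pullback hP ha (h.src _ hr)
  refine ⟨?_, ha, ?_, hr, hfst, hsnd, ?_⟩
  · rw [← h₂]
    exact h.comp _ _ hc (h.pullback H ha (h.src _ hr))
  · rw [← h₁]
    exact h.comp _ _ hc (h.pullback H.flip hr (h.src _ ha))
  · have e : c ≫ H.isoPullback.hom = pullback.lift φ.left b.hom (Arrow.w φ) := by
      apply pullback.hom_ext
      · simp [h₁]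
      · simp [h₂]
    rw [← e]
    exact h.comp _ _ hc (h.ext_of_isIso _ (h.tgt _ hc))

lemma doubleExtension_of_isZero (h : CentralisationLaws O E η T Z) {b a : Arrow C} (φ : b ⟶ a)
    (hb : IsZero b.right) (ha : IsZero a.right) (hφ : E φ.left) : doubleExtension E φ := by
  have : IsIso φ.right := hb.isIso ha _
  exact h.doubleExtension_of_isPullback (q := 𝟙 a.left) (r := 0)
    (IsPullback.of_horiz_isIso ⟨ha.eq_of_tgt _ _⟩) φ.left (Category.comp_id _)
    (hb.eq_of_tgt _ _) (h.to_zero _ (h.tgt _ hφ) ha) (h.zero _ hb ha) hφ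

/-- Changing one coordinate at a time factors the map through `pullback (φ.left ≫ g.hom) g.hom`. The
first factor is a base change of the comparison morphism of `φ`, the second a base change of
`φ.left`. -/
lemma ext_kernelPairMap (h : CentralisationLaws O E η T Z) {f g : Arrow C} {φ : f ⟶ g}
    (hφ : doubleExtension E φ) : E (kernelPairMap φ) := by
  have HQ := IsPullback.of_hasPullback (φ.left ≫ g.hom) g.hom
  have hQ : O (pullback (φ.left ≫ g.hom) g.hom) :=
    h.src _ (h.pullback HQ.flip hφ.target (h.src _ hφ.source))
  have hR : O (pullback g.hom g.hom) :=
    h.src _ (h.pullback (IsPullback.of_hasPullback g.hom g.hom) hφ.target (h.src _ hφ.target))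
  let v : pullback (φ.left ≫ g.hom) g.hom ⟶ pullback g.hom g.hom :=
    pullback.lift (pullback.fst _ _ ≫ φ.left) (pullback.snd _ _)
      (by rw [Category.assoc, pullback.condition])
  have Hv : IsPullback (pullback.fst (φ.left ≫ g.hom) g.hom) v φ.left
      (pullback.fst g.hom g.hom) := by
    refine isPullback_of_elements (pullback.lift_fst _ _ _).symm (fun x y e => ?_)
      (fun z z' e₁ e₂ => ?_)
    · refine ⟨pullback.lift x (y ≫ pullback.snd _ _) ?_, pullback.lift_fst _ _ _, ?_⟩
      · rw [reassoc_of% e, pullback.condition, Category.assoc]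
      · apply pullback.hom_ext <;> simp [v, e]
    · apply pullback.hom_ext
      · exact e₁
      · simpa [v] using congr($e₂ ≫ pullback.snd _ _)
  let u : pullback f.hom f.hom ⟶ pullback (φ.left ≫ g.hom) g.hom :=
    pullback.lift (pullback.fst _ _) (pullback.snd _ _ ≫ φ.left) (by
      rw [Category.assoc, Arrow.w φ, pullback.condition_assoc])
  let k : pullback (φ.left ≫ g.hom) g.hom ⟶ pullback g.hom φ.right :=
    pullback.lift (pullback.snd _ _) (pullback.fst _ _ ≫ f.hom) (by
      rw [Category.assoc, ← Arrow.w φ, pullback.condition])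
  have Hu : IsPullback (pullback.snd f.hom f.hom) u
      (pullback.lift φ.left f.hom (Arrow.w φ)) k := by
    refine isPullback_of_elements ?_ (fun x y e => ?_) (fun z z' e₁ e₂ => ?_)
    · apply pullback.hom_ext
      · simp [u, k]
      · simp [u, k, pullback.condition]
    · have e₁ : x ≫ φ.left = y ≫ pullback.snd _ _ := by
        simpa [k] using congr($e ≫ pullback.fst _ _)
      have e₂ : x ≫ f.hom = y ≫ pullback.fst _ _ ≫ f.hom := by
        simpa [k] using congr($e ≫ pullback.snd _ _)
      refine ⟨pullback.lift (y ≫ pullback.fst _ _) x (by simp [e₂]), by simp, ?_⟩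
      apply pullback.hom_ext <;> simp [u, e₁]
    · apply pullback.hom_ext
      · simpa [u] using congr($e₂ ≫ pullback.fst _ _)
      · exact e₁
  have e : kernelPairMap φ = u ≫ v := by
    apply pullback.hom_ext <;> simp [u, v, kernelPairMap]
  rw [e]
  exact h.comp _ _ (h.pullback Hu hφ.comparison hQ) (h.pullback Hv hφ.left hR)

lemma ext_kernelPair_fst (h : CentralisationLaws O E η T Z) {f : Arrow C} (hf : E f.hom) :
    E (pullback.fst f.hom f.hom) :=
  h.pullback (IsPullback.of_hasPullback f.hom f.hom).flip hf (h.src _ hf)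

lemma ext_kernelPair_snd (h : CentralisationLaws O E η T Z) {f : Arrow C} (hf : E f.hom) :
    E (pullback.snd f.hom f.hom) :=
  h.pullback (IsPullback.of_hasPullback f.hom f.hom) hf (h.src _ hf)

lemma obj_J₁ (h : CentralisationLaws O E η T Z) {f : Arrow C} (hf : E f.hom) : O (J₁ η f) :=
  h.kernel _ (h.J_ext _ (h.ext_kernelPair_fst hf))

/-- `J₁` sends double extensions to extensions. -/
lemma ext_J₁map (h : CentralisationLaws O E η T Z) {f g : Arrow C} {φ : f ⟶ g}
    (hφ : doubleExtension E φ) : E (J₁map η φ) := by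
  have e : (J η).map (pullback.fst f.hom f.hom) ≫ (J η).map φ.left =
      (J η).map (kernelPairMap φ) ≫ (J η).map (pullback.fst g.hom g.hom) := by
    rw [← (J η).map_comp, ← (J η).map_comp]
    simp [kernelPairMap]
  have hd : ∀ a : Arrow C, (J η).map (pullback.lift (𝟙 a.left) (𝟙 a.left) rfl :
      a.left ⟶ pullback a.hom a.hom) ≫ (J η).map (pullback.fst a.hom a.hom) = 𝟙 _ := fun a => by
    rw [← (J η).map_comp, pullback.lift_fst, (J η).map_id]
  have H := IsPullback.of_hasPullback ((J η).map (pullback.fst g.hom g.hom)) ((J η).map φ.left)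
  -- `J` preserves the diagonals, so its values on the first projections are split epimorphisms and
  -- the comparison law applies.
  have hc := h.comparison (pullback.lift _ _ e.symm) (hd f) (hd g) e (by
      rw [← (J η).map_comp, ← (J η).map_comp]
      congr 1
      apply pullback.hom_ext <;> simp [kernelPairMap])
    (h.J_ext _ (h.ext_kernelPair_fst hφ.source)) (h.J_ext _ (h.ext_kernelPair_fst hφ.target))
    (h.J_ext _ (h.ext_kernelPairMap hφ)) (h.J_ext _ hφ.left) H (by simp) (by simp)
  -- Restricting the comparison to pairs whose second entry is 0 gives precisely the map between the
  -- kernels of `J π₁`.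
  refine h.pullback (p := kernel.ι _) (g := pullback.lift (kernel.ι _) 0 (by simp)) ?_ hc
    (h.obj_J₁ hφ.target)
  refine isPullback_of_elements ?_ (fun x y e => ?_) (fun z z' e₁ e₂ => ?_)
  · apply pullback.hom_ext
    · simp [J₁map]
    · simp
  · have e₁ : x ≫ (J η).map (kernelPairMap φ) = y ≫ kernel.ι _ := by
      simpa using congr($e ≫ pullback.fst _ _)
    have e₂ : x ≫ (J η).map (pullback.fst f.hom f.hom) = 0 := by
      simpa using congr($e ≫ pullback.snd _ _)
    refine ⟨kernel.lift _ x e₂, kernel.lift_ι _ _ _, ?_⟩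
    rw [← cancel_mono (kernel.ι _)]
    simp [J₁map, e₁]
  · rwa [← cancel_mono (kernel.ι _)]

/-- `J₁[f]` sits in the kernel pair with first coordinate 0, so the second coordinate determines its
elements. -/
instance mono_ν (f : Arrow C) : Mono (ν η f) := ⟨fun x y e => by
  rw [← cancel_mono (νR η f)]
  apply pullback.hom_ext
  · simp [νR_fst]
  · simpa [νR_snd] using e⟩

section Cokernel

variable [HasNormalImageCokernels C]

/-- `ν_f` is the kernel of its cokernel. -/
lemma exists_ν_lift (h : CentralisationLaws O E η T Z) (f : Arrow C) {X : C} (x : X ⟶ f.left)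
    (hx : x ≫ cokernel.π (ν η f) = 0) : ∃ y, y ≫ ν η f = x := by
  have := h.normal (νR η f) (prod.lift (η.app (pullback f.hom f.hom)) (pullback.fst f.hom f.hom))
    (pullback.snd f.hom f.hom) (pullback.lift (𝟙 _) (𝟙 _) rfl)
    (by rw [νR_snd]; infer_instance) ?_ (fun {X} x hx => ?_) (by simp) x (fun z hz => ?_)
  · simpa only [νR_snd] using this
  · rw [prod.comp_lift, νR_η, νR_fst]
    ext <;> simp
  · have h₁ : x ≫ η.app (pullback f.hom f.hom) = 0 := by simpa using congr($hx ≫ prod.fst)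
    have h₂ : x ≫ pullback.fst f.hom f.hom = 0 := by simpa using congr($hx ≫ prod.snd)
    obtain ⟨y, hy⟩ := exists_J_lift η x h₁
    refine ⟨kernel.lift _ y ?_, by rw [νR, kernel.lift_ι_assoc, hy]⟩
    rw [← cancel_mono ((μ η).app f.left), Category.assoc, μ_nat, ← Category.assoc, hy, h₂,
      zero_comp]
  · rw [νR_snd] at hz
    rw [← cokernel.π_desc (ν η f) z hz, reassoc_of% hx, zero_comp]

/-- `J₁ f` is the initial vertex of the kernel of `η¹_f`. -/
lemma exists_J₁_iso (h : CentralisationLaws O E η T Z) (f : Arrow C) :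
    ∃ i : J₁ η f ⟶ ((J (η₁ η)).obj f).left, IsIso i ∧ i ≫ ((μ (η₁ η)).app f).left = ν η f := by
  let ℓ : Arrow.mk (0 : J₁ η f ⟶ ⊤_ C) ⟶ f := Arrow.homMk (ν η f) 0 (by simp [ν_hom])
  obtain ⟨y, hy⟩ := exists_J_lift (η₁ η) ℓ (by
    apply Arrow.hom_ext
    · exact cokernel.condition (ν η f)
    · exact zero_comp)
  have hy' : y.left ≫ ((μ (η₁ η)).app f).left = ν η f := congr_arg CommaMorphism.left hy
  obtain ⟨z, hz⟩ := h.exists_ν_lift f ((μ (η₁ η)).app f).left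
    (congr_arg CommaMorphism.left (μ_η (η₁ η) f))
  have := arrow_mono_left ((μ (η₁ η)).app f)
  refine ⟨y.left, ⟨z, ?_, ?_⟩, hy'⟩
  · rw [← cancel_mono (ν η f), Category.assoc, hz, hy', Category.id_comp]
  · rw [← cancel_mono ((μ (η₁ η)).app f).left, Category.assoc, hy', hz, Category.id_comp]

/-- The codomain component of `η¹_f` is an identity, so its kernel vanishes. -/
lemma isZero_J_right (f : Arrow C) : IsZero ((J (η₁ η)).obj f).right := by
  have := arrow_mono_right ((μ (η₁ η)).app f)
  have e : ((μ (η₁ η)).app f).right ≫ 𝟙 f.right = 0 :=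
    congr_arg CommaMorphism.right (μ_η (η₁ η) f)
  exact IsZero.of_mono_eq_zero _ ((Category.comp_id _).symm.trans e)

/-- This carries the law `J_ext` up one level: the kernel of `η¹` is concentrated in the initial
vertex, where it is `J₁`. -/
lemma doubleExtension_J (h : CentralisationLaws O E η T Z) {f g : Arrow C} {φ : f ⟶ g}
    (hφ : doubleExtension E φ) : doubleExtension E ((J (η₁ η)).map φ) := by
  refine h.doubleExtension_of_isZero _ (isZero_J_right f) (isZero_J_right g) ?_
  obtain ⟨i, hi, ei⟩ := h.exists_J₁_iso f
  obtain ⟨j, hj, ej⟩ := h.exists_J₁_iso g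
  have := arrow_mono_left ((μ (η₁ η)).app g)
  have e : i ≫ ((J (η₁ η)).map φ).left = J₁map η φ ≫ j := by
    have := congr_arg CommaMorphism.left (μ_nat (η₁ η) φ)
    dsimp at this
    rw [← cancel_mono ((μ (η₁ η)).app g).left, Category.assoc, Category.assoc, ej, J₁map_ν, this,
      reassoc_of% ei]
  refine h.cancel i _ (h.ext_of_isIso i (h.obj_J₁ hφ.source)) ?_
  rw [e]
  exact h.comp _ _ (h.ext_J₁map hφ) (h.ext_of_isIso j (h.obj_J₁ hφ.target))

end Cokernel

end CentralisationLaws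

end CentralisationLaws

/-! ### Inheritance of the laws by arrows, and central extensions as those with zero `J₁` -/

noncomputable section CentralExtensions

variable {C : Type u} [Category.{v} C] [HasZeroMorphisms C] [HasFiniteLimits C]
  {O : ObjectProperty C} {E : MorphismProperty C} {I : C ⥤ C} {η : 𝟭 C ⟶ I}
  {T : MorphismProperty C} {Z : ObjectProperty C}

lemma epi_η₁app [HasNormalImageCokernels C] (η : 𝟭 C ⟶ I) (f : Arrow C) : Epi (η₁app η f) :=
  inferInstance

namespace CentralisationLaws

/-- The law one level down is used twice: on codomains, and on the square formed by the comparison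
morphisms `cx` and `cb`. The pullback in the second square is also the pullback of `P.hom` and
`c.right`, so the result is the comparison morphism of `c`. -/
lemma next_comparison (h : CentralisationLaws O E η T Z) [HasNormalImageCokernels C]
    {X X' B B' P : Arrow C} {p : X ⟶ B}
    {s : B ⟶ X} {p' : X' ⟶ B'} {s' : B' ⟶ X'} {x : X ⟶ X'} {b : B ⟶ B'} {q : P ⟶ X'} {r : P ⟶ B}
    (c : X ⟶ P) (hs : s ≫ p = 𝟙 B) (hs' : s' ≫ p' = 𝟙 B') (w : p ≫ b = x ≫ p')
    (ws : s ≫ x = b ≫ s') (hp : doubleExtension E p) (hp' : doubleExtension E p')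
    (hx : doubleExtension E x) (hb : doubleExtension E b) (H : IsPullback q r p' b)
    (h₁ : c ≫ q = x) (h₂ : c ≫ r = p) : doubleExtension E c := by
  have Hl := isPullback_left H
  have Hr := isPullback_right H
  have l {X Y W : Arrow C} {f : X ⟶ Y} {g : Y ⟶ W} {k : X ⟶ W} (e : f ≫ g = k) :
      f.left ≫ g.left = k.left := congr_arg CommaMorphism.left e
  have r' {X Y W : Arrow C} {f : X ⟶ Y} {g : Y ⟶ W} {k : X ⟶ W} (e : f ≫ g = k) :
      f.right ≫ g.right = k.right := congr_arg CommaMorphism.right e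
  have hP : E P.hom := (h.next.pullback H hp' hb.source).source
  have hcr : E c.right := h.comparison c.right (r' hs) (r' hs') (r' w) (r' ws) hp.right hp'.right
    hx.right hb.right Hr (r' h₁) (r' h₂)
  let cx : X.left ⟶ pullback X'.hom x.right := pullback.lift x.left X.hom (Arrow.w x)
  let cb : B.left ⟶ pullback B'.hom b.right := pullback.lift b.left B.hom (Arrow.w b)
  let u : pullback X'.hom x.right ⟶ pullback B'.hom b.right :=
    pullback.map _ _ _ _ p'.left p.right p'.right (Arrow.w p').symm (r' w).symm
  let σ : pullback B'.hom b.right ⟶ pullback X'.hom x.right :=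
    pullback.map _ _ _ _ s'.left s.right s'.right (Arrow.w s').symm (r' ws).symm
  have hcu : cx ≫ u = p.left ≫ cb := by
    apply pullback.hom_ext
    · simpa [cx, u, cb] using (l w).symm
    · simp [cx, u, cb]
  have hσ : σ ≫ u = 𝟙 _ := by
    apply pullback.hom_ext
    · simpa [σ, u] using congr(pullback.fst _ _ ≫ $(l hs'))
    · simpa [σ, u] using congr(pullback.snd _ _ ≫ $(r' hs))
  -- `u` is not a base change of a given extension; it is an extension because `cx ≫ u = p.left ≫
  -- cb` is one.
  have hu : E u := h.cancel cx u hx.comparison (by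
    rw [hcu]
    exact h.comp _ _ hp.left hb.comparison)
  have hc : E (pullback.lift cx p.left hcu) :=
    h.comparison (s := s.left) (s' := σ) (pullback.lift cx p.left hcu) (l hs) hσ hcu.symm (by
      apply pullback.hom_ext
      · simpa [cx, cb, σ] using l ws
      · simp [cx, cb, σ]) hp.left hu hx.comparison hb.comparison
      (IsPullback.of_hasPullback u cb) (by simp) (by simp)
  have hf : pullback.fst u cb ≫ pullback.fst _ _ ≫ p'.left = pullback.snd u cb ≫ b.left := by
    simpa [u, cb] using congr($(pullback.condition (f := u) (g := cb)) ≫ pullback.fst _ _)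
  have hg : pullback.fst u cb ≫ pullback.snd _ _ ≫ p.right = pullback.snd u cb ≫ B.hom := by
    simpa [u, cb] using congr($(pullback.condition (f := u) (g := cb)) ≫ pullback.snd _ _)
  let q₁ : pullback u cb ⟶ P.left := Hl.lift (pullback.fst u cb ≫ pullback.fst _ _)
    (pullback.snd u cb) (by rw [Category.assoc, hf])
  have hq₁ : q₁ ≫ q.left = pullback.fst u cb ≫ pullback.fst _ _ := Hl.lift_fst _ _ _
  have hr₁ : q₁ ≫ r.left = pullback.snd u cb := Hl.lift_snd _ _ _
  refine h.doubleExtension_of_isPullback (q := q₁) (r := pullback.fst u cb ≫ pullback.snd _ _)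
    (isPullback_of_elements ?_ (fun {V} y z e => ?_) (fun {V} y z e₁ e₂ => ?_))
    (pullback.lift cx p.left hcu) ?_ (by simp [cx]) hP hcr hc
  · apply Hr.hom_ext
    · rw [Category.assoc, Category.assoc, r' h₁, ← Arrow.w q, reassoc_of% hq₁, Category.assoc,
        pullback.condition]
    · rw [Category.assoc, Category.assoc, r' h₂, ← Arrow.w r, reassoc_of% hr₁, Category.assoc, hg]
  · have e₁ : (y ≫ q.left) ≫ X'.hom = z ≫ x.right := by
      rw [Category.assoc, Arrow.w q, reassoc_of% e, r' h₁]
    have e₂ : pullback.lift (y ≫ q.left) z e₁ ≫ u = (y ≫ r.left) ≫ cb := by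
      apply pullback.hom_ext
      · simp [u, cb, Hl.w]
      · have := congr($e ≫ r.right)
        rw [Category.assoc, Category.assoc, r' h₂] at this
        simp [u, cb, this]
    refine ⟨pullback.lift _ _ e₂, ?_, by simp⟩
    apply Hl.hom_ext
    · rw [Category.assoc, hq₁]
      simp
    · rw [Category.assoc, hr₁]
      simp
  · apply pullback.hom_ext
    · apply pullback.hom_ext
      · simpa [hq₁] using congr($e₁ ≫ q.left)
      · simpa using e₂
    · simpa [hr₁] using congr($e₁ ≫ r.left)
  · apply Hl.hom_ext
    · rw [Category.assoc, hq₁, l h₁]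
      simp [cx]
    · rw [Category.assoc, hr₁, l h₂]
      simp

/-- The laws are inherited by the category of arrows. -/
lemma next [HasNormalImageCokernels C] (h : CentralisationLaws O E η T Z) :
    CentralisationLaws (fun f : Arrow C => E f.hom) (doubleExtension E) (η₁ η)
      (fun _ _ t => T t.left ∧ IsIso t.right) (fun f => Z f.left ∧ IsZero f.right) where
  toExtensionLaws := h.toExtensionLaws.next
  corner_ext {X Y} t ht hX := by
    have := ht.2
    have hX' : E X.hom := hX
    exact h.doubleExtension_of_isPullback (q := 𝟙 Y.left) (r := Y.hom ≫ inv t.right)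
      (IsPullback.of_horiz_isIso ⟨by simp⟩) t.left (Category.comp_id _)
      (by rw [← Category.assoc, Arrow.w t]; simp)
      (h.corner_arrow X.hom Y.hom t.left t.right (Arrow.w t) ht.1 ht.2 hX')
      (h.ext_of_isIso _ (h.tgt _ hX')) (h.corner_ext _ ht.1 (h.src _ hX'))
  cancel {X Y W} f g hf hfg := by
    have hr : E g.right := h.cancel f.right _ hf.right hfg.right
    have H := IsPullback.of_hasPullback W.hom (f.right ≫ g.right)
    have wl : (f.left ≫ g.left) ≫ W.hom = X.hom ≫ f.right ≫ g.right := Arrow.w (f ≫ g)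
    have hc : E (pullback.lift (f.left ≫ g.left) X.hom wl) :=
      h.ext_pullback hfg H _ (pullback.lift_fst _ _ _) (pullback.lift_snd _ _ _)
    let t : pullback W.hom (f.right ≫ g.right) ⟶ pullback W.hom g.right :=
      pullback.lift (pullback.fst _ _) (pullback.snd _ _ ≫ f.right) (by
        rw [pullback.condition, Category.assoc])
    -- `t` is a base change of `f.right`. The comparison of `f ≫ g` followed by `t` equals `f.left`
    -- followed by the comparison of `g`, and `f.left` cancels.
    have Ht : IsPullback (pullback.snd _ _) t f.right (pullback.snd W.hom g.right) := by
      refine isPullback_of_elements (by simp [t]) (fun x y e => ?_) (fun z z' e₁ e₂ => ?_)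
      · refine ⟨pullback.lift (y ≫ pullback.fst _ _) x ?_, pullback.lift_snd _ _ _, ?_⟩
        · rw [Category.assoc, pullback.condition, ← reassoc_of% e]
        · apply pullback.hom_ext <;> simp [t, e]
      · apply pullback.hom_ext
        · simpa [t] using congr($e₂ ≫ pullback.fst _ _)
        · exact e₁
    have ht : E t := h.pullback Ht hf.right (h.src _ (h.pullback
      (IsPullback.of_hasPullback W.hom g.right) hfg.target (h.tgt _ hf.right)))
    refine h.doubleExtension_of_isPullback (IsPullback.of_hasPullback W.hom g.right)
      (pullback.lift g.left Y.hom (Arrow.w g)) (by simp) (by simp) hfg.target hr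
      (h.cancel f.left _ hf.left ?_)
    have e : f.left ≫ pullback.lift g.left Y.hom (Arrow.w g) =
        pullback.lift (f.left ≫ g.left) X.hom wl ≫ t := by
      apply pullback.hom_ext <;> simp [t]
    rw [e]
    exact h.comp _ _ hc ht
  to_zero {X Y} f hX hY := by
    have hX' : E X.hom := hX
    have hl := arrow_isZero_left hY
    have hr := arrow_isZero_right hY
    have : IsIso Y.hom := hl.isIso hr _
    exact h.doubleExtension_of_isPullback (q := 0) (r := 𝟙 X.right)
      (IsPullback.of_vert_isIso ⟨hr.eq_of_tgt _ _⟩) X.hom (hl.eq_of_tgt _ _) (Category.comp_id _)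
      (h.zero _ hl hr) (h.to_zero _ (h.tgt _ hX') hr) hX'
  comparison c hs hs' w ws hp hp' hx hb H h₁ h₂ :=
    h.next_comparison c hs hs' w ws hp hp' hx hb H h₁ h₂
  mono {X Y} f hf := by
    have hl : Mono f.left := h.mono f.left fun x hx => by
      refine congr_arg CommaMorphism.left (hf (fromId X x) ?_)
      apply Arrow.hom_ext
      · exact hx
      · simp [fromId, ← Arrow.w, reassoc_of% hx, arrow_zero_right]
    have hr : Mono f.right := h.mono f.right fun x hx => by
      refine congr_arg CommaMorphism.right (hf (fromZero X x) ?_)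
      apply Arrow.hom_ext
      · exact top_hom_ext _ _
      · exact hx
    refine ⟨fun x y e => ?_⟩
    apply Arrow.hom_ext
    · exact (cancel_mono f.left).1 (congr_arg CommaMorphism.left e)
    · exact (cancel_mono f.right).1 (congr_arg CommaMorphism.right e)
  five {X Y A} f g t hf e ht hl := by
    have : IsIso t.left := h.five f.left g.left t.left hf.left (congr_arg CommaMorphism.left e)
      (arrow_mono_left t) fun y hy => by
        obtain ⟨x, hx⟩ := hl (fromId Y y) (by
          apply Arrow.hom_ext
          · exact hy
          · simp [fromId, ← Arrow.w, reassoc_of% hy, arrow_zero_right])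
        exact ⟨x.left, congr_arg CommaMorphism.left hx⟩
    have : IsIso t.right := h.five f.right g.right t.right hf.right
      (congr_arg CommaMorphism.right e) (arrow_mono_right t) fun y hy => by
        obtain ⟨x, hx⟩ := hl (fromZero Y y) (by
          apply Arrow.hom_ext
          · exact top_hom_ext _ _
          · exact hy)
        exact ⟨x.right, congr_arg CommaMorphism.right hx⟩
    exact Arrow.isIso_of_isIso_left_of_isIso_right t
  normal {N R Q B} n g π s hn w hl hs {X} x hx := by
    have ml : Mono (n.left ≫ π.left) := arrow_mono_left (n ≫ π)
    have mr : Mono (n.right ≫ π.right) := arrow_mono_right (n ≫ π)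
    obtain ⟨yl, hyl⟩ := h.normal n.left g.left π.left s.left ml (congr_arg CommaMorphism.left w)
      (fun x hx => by
        obtain ⟨y, hy⟩ := hl (fromId R x) (by
          apply Arrow.hom_ext
          · exact hx
          · simp [fromId, ← Arrow.w, reassoc_of% hx, arrow_zero_right])
        exact ⟨y.left, congr_arg CommaMorphism.left hy⟩)
      -- A test map out of the domain extends to arrows by sending the codomain to 0; below, one out
      -- of the codomain extends through an identity arrow.
      (congr_arg CommaMorphism.left hs) x.left (fun z hz =>
        congr_arg CommaMorphism.left (hx (toZero B z) (by
          apply Arrow.hom_ext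
          · exact hz
          · exact isZero_top.eq_of_tgt _ _)))
    obtain ⟨yr, hyr⟩ := h.normal n.right g.right π.right s.right mr
      (congr_arg CommaMorphism.right w)
      (fun x hx => by
        obtain ⟨y, hy⟩ := hl (fromZero R x) (by
          apply Arrow.hom_ext
          · exact top_hom_ext _ _
          · exact hx)
        exact ⟨y.right, congr_arg CommaMorphism.right hy⟩)
      (congr_arg CommaMorphism.right hs) x.right (fun z hz =>
        congr_arg CommaMorphism.right (hx (toId B z) (by
          apply Arrow.hom_ext
          · change (n ≫ π).left ≫ B.hom ≫ z = 0
            rw [Arrow.w_assoc]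
            exact (congrArg (N.hom ≫ ·) hz).trans comp_zero
          · exact hz)))
    refine ⟨Arrow.homMk yl yr ?_, ?_⟩
    · rw [← cancel_mono (n.right ≫ π.right), Category.assoc, Category.assoc, hyr, ← Arrow.w x,
        ← hyl]
      simp
    · apply Arrow.hom_ext
      · exact hyl
      · exact hyr
  J_ext f hf := h.doubleExtension_J hf

/-- Trivial extensions have zero `J₁`. -/
lemma isZero_J₁_of_isTrivialExtension (f : Arrow C)
    (hf : IsTrivialExtension E η f) : IsZero (J₁ η f) := by
  refine IsZero.of_mono_eq_zero (νR η f) ?_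
  have : ν η f = 0 := by
    -- Triviality makes `η` and `f` jointly monic on the domain, and `ν` is killed by both.
    apply hf.2.hom_ext
    · have := η.naturality (pullback.snd f.hom f.hom)
      dsimp at this
      rw [← νR_snd, Category.assoc, this, ← Category.assoc, νR_η, zero_comp, zero_comp]
    · rw [ν_hom, zero_comp]
  apply pullback.hom_ext
  · rw [νR_fst, zero_comp]
  · rw [νR_snd, this, zero_comp]

/-- Central extensions have zero `J₁`. -/
lemma isZero_J₁_of_isCentralExtension (h : CentralisationLaws O E η T Z) {f : Arrow C}
    (hf : IsCentralExtension E η f) : IsZero (J₁ η f) := by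
  obtain ⟨hE, A', g, hg, ht⟩ := hf
  have H := IsPullback.of_hasPullback f.hom g
  -- The pullback square is a double extension, so `J₁` of it is an extension with zero domain.
  let φ : Arrow.mk (pullback.snd f.hom g) ⟶ f := Arrow.homMk (pullback.fst _ _) g H.w
  have hφ : doubleExtension E φ := h.doubleExtension_of_isPullback (φ := φ) H (𝟙 _)
    (Category.id_comp _) (Category.id_comp _) hE hg (h.ext_of_isIso _ (h.src _ ht.1))
  exact h.isZero_of_isZero _ (h.ext_J₁map hφ) (isZero_J₁_of_isTrivialExtension _ ht)

/-- Extensions with zero `J₁` are central. -/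
lemma isCentralExtension_of_isZero_J₁ (h : CentralisationLaws O E η T Z) {f : Arrow C}
    (hf : E f.hom) (hz : IsZero (J₁ η f)) : IsCentralExtension E η f := by
  -- The splitting extension is `f` itself; its pullback is the second kernel pair projection.
  refine ⟨hf, f.left, f.hom, hf, h.ext_kernelPair_snd hf, ?_⟩
  have hR : O (pullback f.hom f.hom) := h.src _ (h.ext_kernelPair_snd hf)
  -- The twist exchanges the projections, so the kernel of `J π₂` vanishes along with that of `J
  -- π₁`.
  let τ : pullback f.hom f.hom ⟶ pullback f.hom f.hom :=
    pullback.lift (pullback.snd _ _) (pullback.fst _ _) pullback.condition.symm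
  have hτ : (J η).map τ ≫ (J η).map τ = 𝟙 _ := by
    have : τ ≫ τ = 𝟙 _ := by apply pullback.hom_ext <;> simp [τ]
    rw [← (J η).map_comp, this, (J η).map_id]
  have hk : ∀ {W : C} (x : W ⟶ (J η).obj (pullback f.hom f.hom)),
      x ≫ (J η).map (pullback.snd f.hom f.hom) = 0 → x = 0 := fun x hx => by
    have e : (x ≫ (J η).map τ) ≫ (J η).map (pullback.fst f.hom f.hom) = 0 := by
      rw [Category.assoc, ← (J η).map_comp, pullback.lift_fst, hx]
    have e' : x ≫ (J η).map τ = 0 := by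
      rw [← kernel.lift_ι _ _ e, hz.eq_of_src (kernel.ι _) 0, comp_zero]
    rw [← Category.comp_id x, ← hτ, reassoc_of% e', zero_comp]
  have := h.mono _ hk
  have := h.isIso_of_mono _ (h.J_ext _ (h.ext_kernelPair_snd hf))
  have w := η.naturality (pullback.snd f.hom f.hom)
  dsimp at w
  let c : pullback f.hom f.hom ⟶
      pullback (I.map (pullback.snd f.hom f.hom)) (η.app f.left) :=
    pullback.lift (η.app _) (pullback.snd _ _) w.symm
  have : Mono c := h.mono c fun x hx => by
    obtain ⟨z, hz⟩ := exists_J_lift η x (by simpa [c] using congr($hx ≫ pullback.fst _ _))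
    rw [← hz, hk z, zero_comp]
    rw [← cancel_mono ((μ η).app f.left), Category.assoc, μ_nat, reassoc_of% hz]
    simpa [c] using congr($hx ≫ pullback.snd _ _)
  -- Both sides lie over `I` of the kernel pair, with kernels `J` of the kernel pair and `J B`;
  -- these are identified by `J π₂`.
  have : IsIso c := h.five (η.app _) (pullback.fst _ _) c (h.corner_ext _ (h.corner_unit _) hR)
    (pullback.lift_fst _ _ _) inferInstance fun y hy => by
      obtain ⟨z, hz⟩ := exists_J_lift η (y ≫ pullback.snd _ _) (by
        have := congr(y ≫ $(pullback.condition
          (f := I.map (pullback.snd f.hom f.hom)) (g := η.app f.left)))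
        rw [reassoc_of% hy, zero_comp] at this
        rw [Category.assoc]
        exact this.symm)
      refine ⟨(z ≫ inv ((J η).map (pullback.snd f.hom f.hom))) ≫ (μ η).app _, ?_⟩
      apply pullback.hom_ext
      · simp [c, hy, μ_η]
      · rw [Category.assoc, Category.assoc, pullback.lift_snd, ← μ_nat, Category.assoc,
          IsIso.inv_hom_id_assoc, hz]
  exact IsPullback.of_iso_pullback ⟨w.symm⟩ (asIso c) (pullback.lift_fst _ _ _)
    (pullback.lift_snd _ _ _)

variable [HasNormalImageCokernels C]

/-- When `J₁[f]` vanishes, centralising takes the cokernel of a zero map. -/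
lemma isIso_η₁_of_isCentralExtension (h : CentralisationLaws O E η T Z) {f : Arrow C}
    (hf : IsCentralExtension E η f) : IsIso ((η₁ η).app f) := by
  have hν : ν η f = 0 := (h.isZero_J₁_of_isCentralExtension hf).eq_of_src _ _
  have : IsIso ((η₁ η).app f).left := ⟨cokernel.desc (ν η f) (𝟙 _) (by rw [hν, zero_comp]),
    cokernel.π_desc _ _ _, by
      refine (cancel_epi (cokernel.π (ν η f))).1 ?_
      exact (cokernel.π_desc_assoc _ _ _ _).trans
        ((Category.id_comp _).trans (Category.comp_id _).symm)⟩
  have : IsIso ((η₁ η).app f).right := inferInstanceAs (IsIso (𝟙 f.right))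
  exact Arrow.isIso_of_isIso_left_of_isIso_right _

/-- Centralisations are central. -/
lemma isCentralExtension_I₁ (h : CentralisationLaws O E η T Z) {f : Arrow C} (hf : E f.hom) :
    IsCentralExtension E η ((I₁ η).obj f) := by
  have hη : doubleExtension E (η₁app η f) := h.next.corner_ext _ (h.next.corner_unit f) hf
  refine h.isCentralExtension_of_isZero_J₁ hη.target ?_
  -- `ν` of the centralisation is monic, and by naturality its composite with this map is `ν η f`
  -- followed by its own cokernel.
  have e : J₁map η (η₁app η f) = 0 := by
    rw [← cancel_mono (ν η _), J₁map_ν, zero_comp]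
    exact cokernel.condition (ν η f)
  have := h.ext_J₁map hη
  rw [e] at this
  exact h.isZero_of_ext_zero this

end CentralisationLaws

end CentralExtensions

/-! ### Level 0: consequences of the Birkhoff condition -/

section Birkhoff

variable {𝒜 : Type u} [Category.{v} 𝒜] {ℬ : ObjectProperty 𝒜} [Reflective ℬ.ι]

lemma exists_unit_desc {X Y : 𝒜} (f : X ⟶ Y) (hY : ℬ Y) :
    ∃ g, (reflectorAdjunction ℬ.ι).unit.app X ≫ g = f := by
  let g := ((reflectorAdjunction ℬ.ι).homEquiv X ⟨Y, hY⟩).symm f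
  refine ⟨ℬ.ι.map g, ?_⟩
  exact (Adjunction.homEquiv_unit _ _ _ _).symm.trans (Equiv.apply_symm_apply _ _)

lemma unit_desc_unique {X Y : 𝒜} (hY : ℬ Y) (g g' : ℬ.ι.obj ((reflector ℬ.ι).obj X) ⟶ Y)
    (h : (reflectorAdjunction ℬ.ι).unit.app X ≫ g = (reflectorAdjunction ℬ.ι).unit.app X ≫ g') :
    g = g' := by
  have : (ObjectProperty.homMk g : (reflector ℬ.ι).obj X ⟶ (⟨Y, hY⟩ : ℬ.FullSubcategory)) =
      ObjectProperty.homMk g' := by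
    apply ((reflectorAdjunction ℬ.ι).homEquiv X ⟨Y, hY⟩).injective
    rw [Adjunction.homEquiv_unit, Adjunction.homEquiv_unit]
    exact h
  exact congr_arg (fun k => k.hom) this

variable [HasZeroMorphisms 𝒜] [PointedExactProtomodular 𝒜]

/-- The image of the unit is a subobject of an object of `ℬ`, hence lies in `ℬ`. By the universal
property the unit's codomain maps back to it, which splits the inclusion. -/
lemma isRegularEpi_unit (hℬ : IsBirkhoff ℬ) (X : 𝒜) :
    IsRegularEpi ((reflectorAdjunction ℬ.ι).unit.app X) := by
  obtain ⟨M, e, m, he, hm, fac⟩ := exists_image ((reflectorAdjunction ℬ.ι).unit.app X)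
  have hI := ((reflector ℬ.ι).obj X).property
  obtain ⟨t, ht⟩ := exists_unit_desc e (hℬ.subobject m hm hI)
  have htm : t ≫ m = 𝟙 _ := unit_desc_unique hI _ _ (by
    rw [← Category.assoc]
    exact ((congrArg (· ≫ m) ht).trans fac).trans (Category.comp_id _).symm)
  have : IsIso m := ⟨t, by rw [← cancel_mono m, Category.assoc, htm]; simp, htm⟩
  rw [← fac]
  exact isRegularEpi_comp e m he inferInstance

/-- Divide `Y` by the direct image of `J X`. The quotient `Q` is also a regular quotient of `I X`,
so it lies in `ℬ` and `Y ⟶ Q` factors through the unit of `Y`. Hence `J Y` dies in `Q`, which means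
that it is covered by `J X`. -/
lemma isRegularEpi_J_map (hℬ : IsBirkhoff ℬ) {X Y : 𝒜} (f : X ⟶ Y) (hf : IsRegularEpi f) :
    IsRegularEpi ((J (reflectorAdjunction ℬ.ι).unit).map f) := by
  let η := (reflectorAdjunction ℬ.ι).unit
  have hη : IsRegularEpi (η.app X) := isRegularEpi_unit hℬ X
  obtain ⟨Q, c, hc, w, hQ⟩ := exists_direct_image (η.app X) f hf
  have hcf : IsRegularEpi (f ≫ c) := isRegularEpi_comp f c hf hc
  obtain ⟨d, hd⟩ : ∃ d, η.app X ≫ d = f ≫ c := exists_desc (η.app X) (f ≫ c) w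
  have hQℬ : ℬ Q := hℬ.quotient d (isRegularEpi_of_comp (η.app X) d (hd ▸ hcf))
    ((reflector ℬ.ι).obj X).property
  obtain ⟨g, hg⟩ := exists_unit_desc c hQℬ
  obtain ⟨V, ρ, y, hρ, hy, hy'⟩ := hQ ((μ η).app Y) (by
    rw [← hg, ← Category.assoc, μ_η, zero_comp])
  obtain ⟨z, hz⟩ := exists_J_lift η y hy
  refine isRegularEpi_of_comp z _ ?_
  have : z ≫ (J η).map f = ρ := by
    rw [← cancel_mono ((μ η).app Y), Category.assoc, μ_nat, ← hy', ← hz, Category.assoc]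
  rwa [this]

/-- Here `T` is the class of regular epimorphisms: `corner_ext` demands that members of `T` be
extensions, and the Birkhoff condition puts the units in this class. -/
lemma centralisationLaws_base (hℬ : IsBirkhoff ℬ) :
    CentralisationLaws (⊤ : ObjectProperty 𝒜) (MorphismProperty.regularEpi 𝒜)
      (reflectorAdjunction ℬ.ι).unit (MorphismProperty.regularEpi 𝒜) (fun _ => True) where
  src _ _ := trivial
  tgt _ _ := trivial
  zero f hX hY := by
    have : IsIso f := hX.isIso hY f
    exact (inferInstance : IsRegularEpi f)
  comp f g hf hg := isRegularEpi_comp f g hf hg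
  pullback H hf _ := Regular.regularEpiIsStableUnderBaseChange.of_isPullback H hf
  corner_isIso t _ := (inferInstance : IsRegularEpi t)
  corner_ker _ _ _ _ _ := trivial
  corner_coker n t w hc _ := by
    obtain ⟨hc⟩ := hc
    exact ⟨⟨⟨_, n, 0, by rw [w, zero_comp], hc⟩⟩⟩
  corner_obj _ _ _ := trivial
  corner_arrow f f' t w e _ _ hf := by
    refine isRegularEpi_of_comp t f' ?_
    rw [e]
    exact isRegularEpi_comp f w hf inferInstance
  corner_unit X := isRegularEpi_unit hℬ X
  corner_ext _ ht _ := ht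
  cancel f g _ h := isRegularEpi_of_comp f g h
  to_zero {X Y} f _ hY := by
    have : IsSplitEpi f := ⟨⟨⟨0, hY.eq_of_src _ _⟩⟩⟩
    exact (inferInstance : IsRegularEpi f)
  comparison c hs _ w ws _ _ hx _ H h₁ h₂ := isRegularEpi_comparison hs w ws hx H c h₁ h₂
  mono f hf := mono_of_zero_kernel f hf
  five f g t hf w _ h := isIso_of_lift_kernel f g t hf w h
  normal {N R Q B} n g π s hn hg hl hs {X} x hx := by
    have : IsSplitEpi π := ⟨⟨⟨s, hs⟩⟩⟩
    obtain ⟨Y, c, hc, w, hY⟩ := exists_direct_image g π inferInstance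
    have h0 : (n ≫ π) ≫ c = 0 := by
      have := congr(pullback.lift n (0 : N ⟶ R) (by simp [hg]) ≫ $w)
      rw [pullback.lift_fst_assoc, pullback.lift_snd_assoc, zero_comp] at this
      rwa [Category.assoc]
    obtain ⟨V, ρ, y, hρ, hy, hy'⟩ := hY x (hx c h0)
    obtain ⟨z, hz⟩ := hl y hy
    have sq : CommSq z ρ (n ≫ π) x := ⟨by rw [reassoc_of% hz, hy']⟩
    exact ⟨sq.lift, sq.fac_right⟩
  J_ext f hf := isRegularEpi_J_map hℬ f hf

end Birkhoff

/-! ### The laws and centralisation at every level -/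

namespace Stage

/-- The laws which the levels `stage ℬ k` satisfy. -/
def HasLaws (S : Stage.{v, u}) : Prop :=
  ∃ (T : MorphismProperty S.C) (Z : ObjectProperty S.C),
    CentralisationLaws S.ext S.extArrow S.η T Z

/-- Centralisation reflects onto the central objects. -/
structure IsCentralising (S : Stage.{v, u}) : Prop where
  isIso : ∀ X, S.central X → IsIso (S.η.app X)
  central : ∀ X, S.ext X → S.central (S.I.obj X)
  epi : ∀ X, Epi (S.η.app X)

lemma HasLaws.next {S : Stage.{v, u}} (h : S.HasLaws) : S.next.HasLaws := by
  obtain ⟨T, Z, h⟩ := h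
  exact ⟨_, _, h.next⟩

lemma HasLaws.isCentralising_next {S : Stage.{v, u}} (h : S.HasLaws) : S.next.IsCentralising := by
  obtain ⟨T, Z, h⟩ := h
  exact ⟨fun f hf => h.isIso_η₁_of_isCentralExtension hf, fun f hf => h.isCentralExtension_I₁ hf,
    fun f => epi_η₁app S.η f⟩

lemma HasLaws.isCentralising_up {S : Stage.{v, u}} (h : S.HasLaws) (n : ℕ) :
    (S.up (n + 1)).IsCentralising := by
  induction n generalizing S with
  | zero => exact h.isCentralising_next
  | succ n ih => exact ih h.next

lemma hasLaws_base {𝒜 : Type (max u v)} [Category.{v} 𝒜] [HasZeroMorphisms 𝒜]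
    [PointedExactProtomodular 𝒜] {ℬ : ObjectProperty 𝒜} [Reflective ℬ.ι] (hℬ : IsBirkhoff ℬ) :
    (base ℬ).HasLaws :=
  ⟨_, _, centralisationLaws_base (𝒜 := 𝒜) hℬ⟩

lemma hasLaws_stage {𝒜 : Type (max u v)} [Category.{v} 𝒜] [HasZeroMorphisms 𝒜]
    [PointedExactProtomodular 𝒜] {ℬ : ObjectProperty 𝒜} [Reflective ℬ.ι] (hℬ : IsBirkhoff ℬ)
    (k : ℕ) : (stage ℬ k).HasLaws := by
  induction k with
  | zero => exact hasLaws_base hℬ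
  | succ k ih => exact ih.next

end Stage

/-! ### Weakly cartesian lifts, and limits over subcategories and comma categories -/

section Limits

universe v₁ v₂ v₃ u₁ u₂ u₃

variable {X : Type u₁} [Category.{v₁} X] {Y : Type u₂} [Category.{v₂} Y] {Z : Type u₃}
  [Category.{v₃} Z]

/-- Every morphism with codomain `P.obj x` lifts strictly to a morphism with codomain `x` which is
weakly cartesian. -/
def HasWeakLifts (P : X ⥤ Y) : Prop :=
  ∀ (x : X) (a : Y) (g : a ⟶ P.obj x), ∃ (y : X) (e : P.obj y = a) (φ : y ⟶ x),
    P.map φ = eqToHom e ≫ g ∧ ∀ (z : X) (ψ : z ⟶ x) (b : P.obj z ⟶ P.obj y),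
      P.map ψ = b ≫ P.map φ → ∃ χ : z ⟶ y, P.map χ = b ∧ χ ≫ φ = ψ

lemma hasWeakLifts_id : HasWeakLifts (𝟭 X) := fun x a g =>
  ⟨a, rfl, g, by simp, fun z ψ b h => ⟨b, rfl, h.symm⟩⟩

lemma HasWeakLifts.comp {P : X ⥤ Y} {Q : Y ⥤ Z} (hP : HasWeakLifts P) (hQ : HasWeakLifts Q) :
    HasWeakLifts (P ⋙ Q) := fun x a g => by
  obtain ⟨y', e', φ', h', u'⟩ := hQ (P.obj x) a g
  obtain ⟨y, rfl, φ, h, u⟩ := hP x y' φ'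
  rw [eqToHom_refl, Category.id_comp] at h
  subst h
  refine ⟨y, e', φ, h', fun z ψ b hb => ?_⟩
  obtain ⟨χ', hχ', hχ⟩ := u' (P.obj z) (P.map ψ) b hb
  obtain ⟨χ, rfl, hχ''⟩ := u z ψ χ' hχ.symm
  exact ⟨χ, hχ', hχ''⟩

/-- Limits may be restricted to a reflective subcategory when the diagram inverts the units. -/
lemma isLimit_whisker_of_reflection {c : ObjectProperty X} {D : X ⥤ Y} {R : X ⥤ X}
    (η : 𝟭 X ⟶ R) (hR : ∀ x, c (R.obj x)) (hD : ∀ x, IsIso (D.map (η.app x))) {s : Cone D}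
    (hs : IsLimit s) : Nonempty (IsLimit (s.whisker c.ι)) := by
  have key : ∀ (t : Cone (c.ι ⋙ D)) (x : c.FullSubcategory),
      t.π.app x ≫ D.map (η.app x.obj) = t.π.app ⟨R.obj x.obj, hR x.obj⟩ := fun t x =>
    t.w (ObjectProperty.homMk (η.app x.obj) : x ⟶ ⟨R.obj x.obj, hR x.obj⟩)
  -- The component at `x` is forced by naturality along `η.app x`, since `D` inverts it. No
  -- universal property of `R` is needed.
  let ext (t : Cone (c.ι ⋙ D)) : Cone D :=
    { pt := t.pt
      π :=
        { app := fun x => t.π.app ⟨R.obj x, hR x⟩ ≫ inv (D.map (η.app x))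
          naturality := fun x y f => by
            have e₁ : t.π.app ⟨R.obj x, hR x⟩ ≫ D.map (R.map f) = t.π.app ⟨R.obj y, hR y⟩ :=
              t.w (ObjectProperty.homMk (R.map f) :
                (⟨R.obj x, hR x⟩ : c.FullSubcategory) ⟶ ⟨R.obj y, hR y⟩)
            have e₂ : D.map f ≫ D.map (η.app y) = D.map (η.app x) ≫ D.map (R.map f) := by
              rw [← D.map_comp, ← D.map_comp]
              exact congrArg D.map (η.naturality f)
            refine (Category.id_comp _).trans ?_
            rw [IsIso.comp_inv_eq, Category.assoc, Category.assoc, e₂, IsIso.inv_hom_id_assoc,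
              e₁] } }
  refine ⟨{ lift := fun t => hs.lift (ext t), fac := fun t x => ?_, uniq := fun t m hm => ?_ }⟩
  · refine (hs.fac (ext t) x.obj).trans ?_
    rw [IsIso.comp_inv_eq]
    exact (key t x).symm
  · refine hs.hom_ext fun x => ?_
    rw [hs.fac, IsIso.eq_comp_inv, ← hm ⟨R.obj x, hR x⟩, Category.assoc]
    congr 1
    exact s.w (η.app x)

/-- This replaces rewriting inside `StructuredArrow.mk`, on which the type of the component depends.
-/
lemma cone_structuredArrow_congr {P : X ⥤ Y} {D : X ⥤ Z} {a : Y}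
    (t : Cone (StructuredArrow.proj a P ⋙ D)) (x : X) {f g : a ⟶ P.obj x} (e : f = g) :
    t.π.app (StructuredArrow.mk f) = t.π.app (StructuredArrow.mk g) := by
  subst e
  rfl

/-- Limits over comma categories of a composite functor may be computed in two steps. -/
lemma existsUnique_lift_structuredArrow {P : X ⥤ Y} {Q K : Y ⥤ Z} {H : Y ⥤ Y} {G : X ⥤ Y}
    (d : P ⋙ H ⟶ G)
    (hH : ∀ b, Nonempty (IsLimit (K.mapCone ((Functor.RightExtension.mk H d).coneAt b)))) {a : Z}
    {c : Cone (StructuredArrow.proj a Q ⋙ H ⋙ K)} (hc : IsLimit c)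
    (t : Cone (StructuredArrow.proj a (P ⋙ Q) ⋙ G ⋙ K)) :
    ∃! m : t.pt ⟶ c.pt, ∀ w : StructuredArrow a (P ⋙ Q),
      m ≫ c.π.app (StructuredArrow.mk (S := a) (T := Q) (Y := P.obj w.right) w.hom) ≫
        K.map (d.app w.right) = t.π.app w := by
  -- For fixed `w`, composing its structure map with `Q` of arrows `w.right ⟶ P.obj x` restricts `t`
  -- to the inner comma category. The induced maps `lb w` into the inner limits then form a cone for
  -- the outer limit.
  let tb (w : StructuredArrow a Q) :
      Cone ((StructuredArrow.proj w.right P ⋙ G) ⋙ K) :=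
    { pt := t.pt
      π :=
        { app := fun z => t.π.app (StructuredArrow.mk (S := a) (T := P ⋙ Q) (Y := z.right)
            (w.hom ≫ Q.map z.hom))
          naturality := fun z z' f => by
            let f' : StructuredArrow.mk (S := a) (T := P ⋙ Q) (Y := z.right)
                (w.hom ≫ Q.map z.hom) ⟶ StructuredArrow.mk (S := a) (T := P ⋙ Q) (Y := z'.right)
                (w.hom ≫ Q.map z'.hom) := StructuredArrow.homMk f.right (by
              dsimp
              rw [Category.assoc, ← Q.map_comp, StructuredArrow.w f])
            exact (Category.id_comp _).trans (t.w f').symm } }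
  let lb (w : StructuredArrow a Q) : t.pt ⟶ K.obj (H.obj w.right) := (hH w.right).some.lift (tb w)
  have fac (w : StructuredArrow a Q) (x : X) (g : w.right ⟶ P.obj x) :
      lb w ≫ K.map (H.map g) ≫ K.map (d.app x) =
        t.π.app (StructuredArrow.mk (S := a) (T := P ⋙ Q) (Y := x) (w.hom ≫ Q.map g)) := by
    refine Eq.trans ?_ ((hH w.right).some.fac (tb w) (StructuredArrow.mk g))
    rw [← K.map_comp]
    rfl
  have ext (w : StructuredArrow a Q) {m m' : t.pt ⟶ K.obj (H.obj w.right)}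
      (h : ∀ (x : X) (g : w.right ⟶ P.obj x), m ≫ K.map (H.map g) ≫ K.map (d.app x) =
        m' ≫ K.map (H.map g) ≫ K.map (d.app x)) : m = m' := by
    refine (hH w.right).some.hom_ext fun z => ?_
    have := h z.right z.hom
    rw [← K.map_comp] at this
    exact this
  let tc : Cone (StructuredArrow.proj a Q ⋙ H ⋙ K) :=
    { pt := t.pt
      π :=
        { app := lb
          naturality := fun w w' f => by
            refine (Category.id_comp _).trans (ext w' fun x g => ?_)
            rw [fac]
            have := fac w x (f.right ≫ g)
            rw [H.map_comp, K.map_comp, Category.assoc] at this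
            refine Eq.trans ?_ (this.symm.trans (Category.assoc _ _ _).symm)
            refine cone_structuredArrow_congr (P := P ⋙ Q) (D := G ⋙ K) t x ?_
            rw [← StructuredArrow.w f, Q.map_comp, Category.assoc] } }
  refine ⟨hc.lift tc, fun w => ?_, fun m hm => hc.hom_ext fun w => ?_⟩
  · rw [← Category.assoc, hc.fac]
    -- The identity of `P.obj w.right`, viewed as an object of the inner comma category, recovers
    -- the component of `t` at `w`.
    have := fac (StructuredArrow.mk (S := a) (T := Q) (Y := P.obj w.right) w.hom) w.right (𝟙 _)
    rw [H.map_id, K.map_id] at this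
    refine (congrArg (lb _ ≫ ·) (Category.id_comp _).symm).trans (this.trans ?_)
    refine cone_structuredArrow_congr (P := P ⋙ Q) (D := G ⋙ K) t w.right ?_
    rw [Q.map_id]
    exact Category.comp_id _
  · rw [hc.fac]
    refine ext w fun x g => ?_
    have e : c.π.app w ≫ K.map (H.map g) = c.π.app
        (StructuredArrow.mk (S := a) (T := Q) (Y := P.obj x) (w.hom ≫ Q.map g)) :=
      c.w (StructuredArrow.homMk g rfl : w ⟶
        StructuredArrow.mk (S := a) (T := Q) (Y := P.obj x) (w.hom ≫ Q.map g))
    refine Eq.trans ?_ ((hm (StructuredArrow.mk (S := a) (T := P ⋙ Q) (Y := x)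
      (w.hom ≫ Q.map g))).trans (fac w x g).symm)
    exact (Category.assoc _ _ _).trans (congrArg (m ≫ ·)
      ((Category.assoc _ _ _).symm.trans (congrArg (· ≫ K.map (d.app x)) e)))

end Limits

/-! ### The canonical homology cone is a limit cone -/

noncomputable section StageLimits

/-- The bijection of hom-sets exhibiting `X ↦ (X ⟶ 0)` as left adjoint to the kernel functor. -/
def kerArrowHomEquiv {C : Type u} [Category.{v} C] [HasZeroMorphisms C] [HasFiniteLimits C]
    (X : C) (f : Arrow C) :
    (Arrow.mk (0 : X ⟶ ⊤_ C) ⟶ f) ≃ (X ⟶ kernel f.hom) where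
  toFun φ := kernel.lift f.hom φ.left (by rw [Arrow.w φ]; exact zero_comp)
  invFun x := Arrow.homMk (x ≫ kernel.ι f.hom) 0 (by simp)
  left_inv φ := by
    apply Arrow.hom_ext
    · exact kernel.lift_ι _ _ _
    · exact top_hom_ext _ _
  right_inv x := by
    rw [← cancel_mono (kernel.ι f.hom)]
    exact kernel.lift_ι _ _ _

lemma kerArrowHomEquiv_naturality {C : Type u} [Category.{v} C] [HasZeroMorphisms C]
    [HasFiniteLimits C] (X : C) {f g : Arrow C} (ψ : f ⟶ g) (φ : Arrow.mk (0 : X ⟶ ⊤_ C) ⟶ f) :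
    kerArrowHomEquiv X g (φ ≫ ψ) = kerArrowHomEquiv X f φ ≫
      kernel.map f.hom g.hom ψ.left ψ.right (Arrow.w ψ).symm := by
  rw [← cancel_mono (kernel.ι g.hom)]
  simp [kerArrowHomEquiv]

namespace Stage

variable {S : Stage.{v, u}}

/-- Ensures that the left adjoint $X\mapsto(X\to 0)$ of the kernel functor lands in extensions. -/
lemma HasLaws.to_zero (h : S.HasLaws) (X : S.Ext) : S.extArrow (0 : X.obj ⟶ ⊤_ S.C) := by
  obtain ⟨T, Z, h⟩ := h
  exact h.to_zero _ X.property isZero_top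

/-- The kernel functor is a right adjoint. -/
lemma HasLaws.isRightAdjoint_ker (h : S.HasLaws) : S.ker.IsRightAdjoint :=
  (Adjunction.adjunctionOfEquivLeft (G := S.ker)
    (F_obj := fun X => ⟨Arrow.mk (0 : X.obj ⟶ ⊤_ S.C), h.to_zero X⟩)
    (fun X f =>
      { toFun := fun φ => ObjectProperty.homMk (kerArrowHomEquiv X.obj f.obj φ.hom)
        invFun := fun x => ObjectProperty.homMk ((kerArrowHomEquiv X.obj f.obj).symm x.hom)
        left_inv := fun φ => ObjectProperty.hom_ext _
          ((kerArrowHomEquiv X.obj f.obj).symm_apply_apply φ.hom)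
        right_inv := fun x => ObjectProperty.hom_ext _
          ((kerArrowHomEquiv X.obj f.obj).apply_symm_apply x.hom) })
    (fun X _ _ ψ φ => ObjectProperty.hom_ext _
      (kerArrowHomEquiv_naturality X.obj ψ.hom φ.hom))).isRightAdjoint

/-- As a right adjoint, `ker` preserves the pointwise limits that define `H'`, so the two-step
computation of limits applies. -/
lemma isLimit_connectCone (h : S.HasLaws) {n : ℕ} {H' : S.next.Ext ⥤ S.next.Ext}
    {d : S.next.codN n ⋙ H' ⟶ S.next.kerI n}
    (hH : ∀ B, Nonempty (IsLimit ((Functor.RightExtension.mk H' d).coneAt B))) {A : S.Ext}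
    {c : Cone (StructuredArrow.proj A S.cod ⋙ H' ⋙ S.ker)} (hc : IsLimit c) :
    Nonempty (IsLimit (connectCone d c)) := by
  have := h.isRightAdjoint_ker
  have key := fun t => existsUnique_lift_structuredArrow (Q := S.cod) (K := S.ker) d
    (fun B => ⟨isLimitOfPreserves S.ker (hH B).some⟩) hc t
  exact ⟨{ lift := fun t => (key t).choose
           fac := fun t w => (key t).choose_spec.1 w
           uniq := fun t m hm => (key t).choose_spec.2 m hm }⟩

lemma isLimit_coneAt_of_isHomologyFunctor {n : ℕ} {S : Stage.{v, u}} {H : S.Ext ⥤ S.Ext}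
    {d : S.codN n ⋙ H ⟶ S.kerI n} (hd : IsHomologyFunctor n S H d) (h : S.HasLaws) (A : S.Ext) :
    Nonempty (IsLimit ((Functor.RightExtension.mk H d).coneAt A)) := by
  induction hd with
  | zero S =>
    -- For `n = 0` the comma category has the initial object `(A, 1_A)`, so the limit is the value
    -- there.
    refine ⟨{ lift := fun t => t.π.app (StructuredArrow.mk (S := A) (T := 𝟭 S.Ext) (𝟙 A))
              fac := fun t w => ?_
              uniq := fun t m hm => ?_ }⟩
    · exact (congrArg (_ ≫ ·) (Category.comp_id _)).trans
        (t.w (StructuredArrow.homMk w.hom (Category.id_comp _) :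
          StructuredArrow.mk (S := A) (T := 𝟭 S.Ext) (𝟙 A) ⟶ w))
    · have e : S.IExt.map (𝟙 A) ≫ 𝟙 (S.IExt.obj A) = 𝟙 (S.IExt.obj A) := by
        rw [S.IExt.map_id, Category.id_comp]
      exact ((Category.comp_id m).symm.trans (congrArg (m ≫ ·) e.symm)).trans
        (hm (StructuredArrow.mk (S := A) (T := 𝟭 S.Ext) (𝟙 A)))
  | succ n S H' d H δ hd hδ ih =>
    obtain ⟨hδ⟩ := hδ
    obtain ⟨hl⟩ := isLimit_connectCone h (fun B => ih h.next B) (hδ A)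
    exact ⟨hl.ofIsoLimit (Cone.ext (Iso.refl _) fun w => by
      refine Eq.trans ?_ (Category.id_comp _).symm
      exact Category.assoc _ _ _)⟩

lemma isLimit_of_isHomologyCone {S : Stage.{v, u}} {n : ℕ} {A : S.Ext}
    {s : Cone (commaDiagram n A)} (hs : IsHomologyCone n A s) (h : S.HasLaws) : Nonempty (IsLimit s) := by
  cases hs with
  | functor n A H d hd => exact isLimit_coneAt_of_isHomologyFunctor hd h A
  | object n A H' d c hd hc =>
    exact isLimit_connectCone h (isLimit_coneAt_of_isHomologyFunctor hd h.next) hc.some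
  | limit n A s hs => exact hs

end Stage

end StageLimits

/-! ### Extensions of a fixed object: initiality and centralisation -/

namespace Stage

variable {S : Stage.{v, u}}

/-- Extensions may be pulled back along morphisms of extensions. -/
lemma hasWeakLifts_cod (S : Stage.{v, u}) : HasWeakLifts S.cod := fun X A g => by
  let f : Arrow S.C := X.obj
  let g' : A.obj ⟶ f.right := g.hom
  have hE : S.extArrow (pullback.snd f.hom g') := by
    obtain ⟨T, Z, h⟩ := S.lawful
    exact h.pullback (IsPullback.of_hasPullback f.hom g') X.property A.property
  let y : S.next.Ext := ⟨Arrow.mk (pullback.snd f.hom g'), hE⟩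
  let φ' : Arrow.mk (pullback.snd f.hom g') ⟶ f :=
    Arrow.homMk (pullback.fst f.hom g') g' pullback.condition
  let φ : y ⟶ X := ObjectProperty.homMk φ'
  refine ⟨y, rfl, φ, (Category.id_comp g).symm, fun z ψ b hb => ?_⟩
  let ψ' : (z.obj : Arrow S.C) ⟶ f := ψ.hom
  let b' : (z.obj : Arrow S.C).right ⟶ A.obj := b.hom
  have hb' : ψ'.right = b' ≫ g' := congrArg (fun k => k.hom) hb
  let χ : (z.obj : Arrow S.C) ⟶ Arrow.mk (pullback.snd f.hom g') :=
    Arrow.homMk (pullback.lift ψ'.left ((z.obj : Arrow S.C).hom ≫ b') (by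
      rw [Category.assoc, ← hb', Arrow.w ψ'])) b' (pullback.lift_snd _ _ _)
  refine ⟨ObjectProperty.homMk χ, rfl, ObjectProperty.hom_ext _ ?_⟩
  have : χ ≫ φ' = ψ' := by
    apply Arrow.hom_ext
    · exact pullback.lift_fst _ _ _
    · exact hb'.symm
  exact this

lemma hasWeakLifts_codN (S : Stage.{v, u}) (n : ℕ) : HasWeakLifts (S.codN n) := by
  induction n generalizing S with
  | zero => exact hasWeakLifts_id
  | succ n ih => exact (ih S.next).comp S.hasWeakLifts_cod

lemma isHomLift_of_map_eq {n : ℕ} {A : S.Ext} {x y : (S.up n).Ext} (hx : (S.codN n).obj x = A)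
    (hy : (S.codN n).obj y = A) (φ : x ⟶ y) (h : (S.codN n).map φ = eqToHom (hx.trans hy.symm)) :
    (S.codN n).IsHomLift (𝟙 A) φ :=
  IsHomLift.of_fac' (S.codN n) (𝟙 A) φ hx hy (by rw [h]; simp)

/-- Pulling back along the structure map of `w` yields an object over `w` to which every other
object over `w` maps. Uniqueness of these maps is not needed for connectedness. -/
lemma initial_toComma (n : ℕ) (A : S.Ext) : (toComma n A).Initial where
  out w := by
    obtain ⟨y, e, φ, h, u⟩ := S.hasWeakLifts_codN n w.right A w.hom
    let y' : ExtOver n A := ⟨y, e⟩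
    let φ' : (toComma n A).obj y' ⟶ w := StructuredArrow.homMk φ (by
      refine (congrArg (eqToHom e.symm ≫ ·) h).trans ?_
      simp)
    let j : CostructuredArrow (toComma n A) w := CostructuredArrow.mk φ'
    have key : ∀ i : CostructuredArrow (toComma n A) w, Nonempty (i ⟶ j) := fun i => by
      have hi : eqToHom i.left.2.symm ≫ (S.codN n).map i.hom.right = w.hom :=
        StructuredArrow.w i.hom
      obtain ⟨χ, hχ, hχ'⟩ := u i.left.1 i.hom.right (eqToHom (i.left.2.trans e.symm)) (by
        rw [h, ← hi]
        simp)
      let χ' : i.left ⟶ y' := ⟨χ, isHomLift_of_map_eq i.left.2 e χ hχ⟩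
      exact ⟨CostructuredArrow.homMk χ' (StructuredArrow.hom_ext _ _ hχ')⟩
    have : Nonempty (CostructuredArrow (toComma n A) w) := ⟨j⟩
    exact zigzag_isConnected fun i i' =>
      (Zigzag.of_hom (key i).some).trans (Zigzag.of_inv (key i').some)

/-- The unit of `I` is sent to an identity by `codⁿ`. -/
lemma codN_ηExt (S : Stage.{v, u}) (n : ℕ) (f : (S.up (n + 1)).Ext) :
    ∃ e : (S.codN (n + 1)).obj f = (S.codN (n + 1)).obj ((S.up (n + 1)).IExt.obj f),
      (S.codN (n + 1)).map ((S.up (n + 1)).ηExt.app f) = eqToHom e := by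
  induction n generalizing S with
  | zero => exact ⟨rfl, rfl⟩
  | succ n ih =>
    obtain ⟨e, h⟩ := ih S.next f
    refine ⟨congrArg S.cod.obj e, ?_⟩
    exact (congrArg S.cod.map h).trans (eqToHom_map S.cod e)

section Centralise

variable (n : ℕ) (A : S.Ext)

/-- Centralisation of `n`-extensions of `A`. -/
noncomputable def centraliseOver : ExtOver (n + 1) A ⥤ ExtOver (n + 1) A where
  obj f := ⟨(S.up (n + 1)).IExt.obj f.1, (S.codN_ηExt n f.1).choose.symm.trans f.2⟩
  map {f g} φ := ⟨(S.up (n + 1)).IExt.map φ.1, by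
    obtain ⟨ef, hf⟩ := S.codN_ηExt n f.1
    obtain ⟨eg, hg⟩ := S.codN_ηExt n g.1
    refine isHomLift_of_map_eq (ef.symm.trans f.2) (eg.symm.trans g.2) _ ?_
    -- Applying `codⁿ⁺¹` to naturality of the unit, with both unit components becoming `eqToHom`,
    -- forces the image of the centralised morphism to be an `eqToHom` too.
    have h := congrArg (S.codN (n + 1)).map ((S.up (n + 1)).ηExt.naturality φ.1)
    rw [Functor.map_comp, Functor.map_comp, hf, hg] at h
    have := φ.2
    rw [Functor.id_map, IsHomLift.fac' (S.codN (n + 1)) (𝟙 A) φ.1] at h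
    rw [← cancel_epi (eqToHom ef), ← h]
    simp⟩
  map_id f := Functor.Fiber.hom_ext ((S.up (n + 1)).IExt.map_id f.1)
  map_comp φ ψ := Functor.Fiber.hom_ext ((S.up (n + 1)).IExt.map_comp φ.1 ψ.1)

/-- The unit of centralisation of `n`-extensions of `A`. -/
noncomputable def ηOver : 𝟭 (ExtOver (n + 1) A) ⟶ centraliseOver n A where
  app f := ⟨(S.up (n + 1)).ηExt.app f.1, by
    obtain ⟨e, h⟩ := S.codN_ηExt n f.1
    exact isHomLift_of_map_eq f.2 (e.symm.trans f.2) _ h⟩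
  naturality f g φ := Functor.Fiber.hom_ext ((S.up (n + 1)).ηExt.naturality φ.1)

end Centralise

lemma IsCentralising.isIso_ηExt (h : S.IsCentralising) (f : S.Ext) (hf : S.central f.obj) :
    IsIso (S.ηExt.app f) := by
  obtain ⟨g, h₁, h₂⟩ := h.isIso f.obj hf
  exact ⟨ObjectProperty.homMk g, ObjectProperty.hom_ext _ h₁, ObjectProperty.hom_ext _ h₂⟩

/-- Naturality and epimorphic units give `I η = η I`, and `η I` is invertible because
centralisations are central. -/
lemma IsCentralising.isIso_IExt_map (h : S.IsCentralising) (f : S.Ext) :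
    IsIso (S.IExt.map (S.ηExt.app f)) := by
  have e : S.I.map (S.η.app f.obj) = S.η.app (S.I.obj f.obj) := by
    have := h.epi f.obj
    rw [← cancel_epi (S.η.app f.obj)]
    exact (S.η.naturality (S.η.app f.obj)).symm
  have e' : S.IExt.map (S.ηExt.app f) = S.ηExt.app (S.IExt.obj f) := ObjectProperty.hom_ext _ e
  rw [e']
  exact h.isIso_ηExt _ (h.central _ f.property)

end Stage

end Satellite

/-! ### Homology as a limit over extensions and over central extensions -/

theorem mainTheorem8 {𝒜 : Type (max u v)} [Category.{v} 𝒜] [HasZeroMorphisms 𝒜]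
    [Satellite.PointedExactProtomodular 𝒜] (ℬ : ObjectProperty 𝒜) [Reflective ℬ.ι]
    (hℬ : Satellite.IsBirkhoff ℬ) (k n : ℕ) (hn : 1 ≤ n) (A : (Satellite.stage ℬ k).Ext)
    (s : Cone (Satellite.Stage.commaDiagram n A)) (hs : Satellite.Stage.IsHomologyCone n A s) :
    Nonempty (IsLimit (Satellite.Stage.extCone s)) ∧
      ∃ σ : (Functor.const _).obj s.pt ⟶ Satellite.Stage.centralDiagram n A,
        (∀ f : Satellite.Stage.CExtOver n A,
          σ.app f ≫ (Satellite.Stage.centralUnit n A).app f =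
            (Satellite.Stage.extCone s).π.app
              ((Satellite.Stage.centralInclusion n A).obj f)) ∧
        Nonempty (IsLimit (Cone.mk s.pt σ)) := by
  have hS := Satellite.Stage.hasLaws_stage hℬ k
  -- Positivity of `n` places the unit at a level built by centralisation, where `codⁿ` sends it to
  -- an identity, so it stays over `A`.
  obtain ⟨n, rfl⟩ : ∃ m, n = m + 1 := ⟨n - 1, by omega⟩
  have hc := hS.isCentralising_up n
  have := Satellite.Stage.initial_toComma (n + 1) A
  obtain ⟨hl⟩ := Satellite.Stage.isLimit_of_isHomologyCone hs hS
  let he : IsLimit (Satellite.Stage.extCone s) :=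
    (Functor.Initial.isLimitWhiskerEquiv (Satellite.Stage.toComma (n + 1) A) s).symm hl
  obtain ⟨hw⟩ := Satellite.isLimit_whisker_of_reflection
    (c := Satellite.Stage.isCentralOver (n + 1) A) (Satellite.Stage.ηOver n A)
    (fun f => hc.central _ f.1.property) (fun f => by
      have := hc.isIso_IExt_map f.1
      exact Functor.map_isIso (((Satellite.stage ℬ k).kerN (n + 1)))
        (((Satellite.stage ℬ k).up (n + 1)).IExt.map
          (((Satellite.stage ℬ k).up (n + 1)).ηExt.app f.1))) he
  have (f : Satellite.Stage.CExtOver (n + 1) A) :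
      IsIso ((Satellite.Stage.centralUnit (n + 1) A).app f) := by
    have := hc.isIso_ηExt _ f.property
    exact Functor.map_isIso (((Satellite.stage ℬ k).kerN (n + 1)))
      (((Satellite.stage ℬ k).up (n + 1)).ηExt.app f.obj.1)
  -- Invertibility on central extensions leaves one choice for `σ`: the restricted cone of part 1
  -- followed by the inverse.
  have : IsIso (Satellite.Stage.centralUnit (n + 1) A) := NatIso.isIso_of_isIso_app _
  let τ : (Functor.const _).obj s.pt ⟶ Satellite.Stage.centralInclusion (n + 1) A ⋙
      Satellite.Stage.extDiagram (n + 1) A := ((Satellite.Stage.extCone s).whisker _).π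
  have hτ : (τ ≫ inv (Satellite.Stage.centralUnit (n + 1) A)) ≫
      Satellite.Stage.centralUnit (n + 1) A = τ := by
    rw [Category.assoc, IsIso.inv_hom_id, Category.comp_id]
  exact ⟨⟨he⟩, τ ≫ inv (Satellite.Stage.centralUnit (n + 1) A),
    fun f => congrArg (fun ρ => NatTrans.app ρ f) hτ,
    ⟨(IsLimit.postcomposeHomEquiv (asIso (Satellite.Stage.centralUnit (n + 1) A)).symm _).symm
      hw⟩⟩
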